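/- **Super-Yangians.** Let $c\in\mathbb C\setminus\{0\}$ and $\kappa\in\mathbb C$. For a $\mathbb Z_2$-grading $[\cdot]$ of $\{1,2,3\}$ let $Y_\kappa$ be the unital associative $\mathbb C$-algebra generated by $T^{(r)}_{ij}$ ($1\le i,j\le 3$, $r\ge 0$), of parity $[i]+[j]$, with the relations (read coefficientwise, after multiplication by $(z-w)/c$) $$T_{ij}(z)T_{kl}(w)-(-1)^{([i]+[j])([k]+[l])}T_{kl}(w)T_{ij}(z)=(-1)^{[l]([i]+[j])+[i][j]}g(z,w)\big(T_{il}(z)T_{kj}(w)-T_{il}(w)T_{kj}(z)\big),$$ where $T_{ij}(u)=\kappa\,\delta_{ij}+\sum_{r\ge0}T^{(r)}_{ij}(c/u)^{r+1}$ and $g(z,w)=c/(z-w)$; these are the entries of the $RTT$ relation. Write $Y_\kappa(2|1)$ for the grading $[1]=[2]=0,[3]=1$, and $Y_\kappa(1|2)$, with generators $\widetilde T_{ij}$, for the grading $\widetilde{[1]}=0$, $\widetilde{[2]}=\widetilde{[3]}=1$. For $\kappa=1$ these are the usual super-Yangians $Y(2|1)$ and $Y(1|2)$. With $\bar\jmath=4-j$,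 the formulas $$\varphi(T_{ij}(u))=(-1)^{[i][j]+[j]+1}\,\widetilde T_{\bar\jmath\,\bar\imath}(u),\qquad \widetilde\varphi(\widetilde T_{ij}(u))=(-1)^{\widetilde{[i]}\widetilde{[j]}+\widetilde{[j]}+1}\,T_{\bar\jmath\,\bar\imath}(u)$$ define algebra isomorphisms $\varphi:Y_\kappa(2|1)\to Y_{-\kappa}(1|2)$ and $\widetilde\varphi:Y_\kappa(1|2)\to Y_{-\kappa}(2|1)$ (the leading term $\kappa$ changes sign because of the factor $-1$ on the diagonal generators). **Singular vectors.** A vector $\Omega$ of a module is singular of weights $\lambda_i(u)$ if $T_{ii}(u)\Omega=\lambda_i(u)\Omega$ for all $i$ and $T_{ij}(u)\Omega=0$ for $i>j$. **Spectral parameters.** Let $\Gamma$ be a linearly ordered abelian group and $K=\mathbb C((t^\Gamma))$ the field of Hahn series. Bethe parameters are elements $u_1,\dots,u_a,v_1,\dots,v_b$ of $K$ of negative order (for instance independent formal variables, whose inverses are infinitesimal) with $u_k\ne v_j$ for all $k,j$. Thus $T_{ij}(u_k)$, $T_{ij}(v_j)$ are Hahn series with coefficients in $Y_\kappa$, acting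 on Hahn series with coefficients in a $Y_\kappa$-module. **Bethe vectors.** Let $\mathrm E_{ij}^{(q)}$ be the elementary matrix in the $q$-th factor of the graded tensor product $\mathrm{End}(\mathbb C^{m|n})^{\otimes(a+b)}$, $(m|n)=(2|1)$ or $(1|2)$, let $T_q(u)=\sum_{i,j}\mathrm E_{ij}^{(q)}\otimes T_{ij}(u)$ (graded tensor product), let $P_{qr}=\sum_{i,j}(-1)^{[j]}\mathrm E^{(q)}_{ij}\mathrm E^{(r)}_{ji}$, let $\mathrm{str}$ be the super-trace over all $a+b$ factors, where $\mathrm{str}\,\mathrm E_{ij}=(-1)^{[j]}\delta_{ij}$, and put $R_{a+j,k}=1+g(v_j,u_k)P_{a+j,k}$, $$\mathbb R=(R_{a+1,a}\cdots R_{a+1,1})(R_{a+2,a}\cdots R_{a+2,1})\cdots(R_{a+b,a}\cdots R_{a+b,1}),$$ $$S_{ab}(\bar u,\bar v)=\mathrm{str}\big[T_1(u_1)\cdots T_a(u_a)\,T_{a+1}(v_1)\cdots T_{a+b}(v_b)\,\mathbb R\,\mathrm E_{21}^{(1)}\cdots\mathrm E_{21}^{(a)}\,\mathrm E_{32}^{(a+1)}\cdots\mathrm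 E_{32}^{(a+b)}\big],$$ $H(\bar w)=\prod_{k<j}h(w_j,w_k)$ with $h(x,y)=(x-y+c)/c$. For a singular vector $\Omega$ of a $Y_\kappa(2|1)$-module, resp. a singular vector $\widetilde\Omega$ of a $Y_\kappa(1|2)$-module, the Bethe vectors are $$\Phi_{ab}(\bar u,\bar v)=\frac{(-1)^b}{H(\bar v)}\,S_{ab}(\bar u,\bar v)\,\Omega,\qquad \widetilde\Phi_{ab}(\bar u,\bar v)=\frac{(-1)^a}{H(\bar u)}\,\widetilde S_{ab}(\bar u,\bar v)\,\widetilde\Omega,$$ where $\widetilde S_{ab}$ is $S_{ab}$ for $Y(1|2)$ (with the convention $1/0=0$, which matters only for non-generic parameters). **Statement.** Let $a,b\ge0$. 1. Let $V$ be a $Y_\kappa(2|1)$-module, $W$ a $Y_{-\kappa}(1|2)$-module, and $\varphi:V\to W$ an additive map compatible with the algebra isomorphism, $\varphi(yx)=\varphi(y)\varphi(x)$ (for instance the identity map, if $W$ is $V$ with the action transported through $\varphi$). If $\Omega\in V$ is singular of weights $\lambda_i(u)$, then $\widetilde\Omega=\varphi(\Omega)$ is singular of weights $\widetilde\lambda_i(u)=-\lambda_{4-i}(u)$,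 and, applying $\varphi$ coefficientwise, $$\varphi\big(\Phi_{ab}(\bar u,\bar v)\big)=\widetilde\Phi_{ba}(\bar v,\bar u).$$ 2. Likewise, let $V$ be a $Y_\kappa(1|2)$-module, $W$ a $Y_{-\kappa}(2|1)$-module, and $\widetilde\varphi:V\to W$ an additive map compatible with the algebra isomorphism $\widetilde\varphi$. If $\widetilde\Omega\in V$ is singular of weights $\widetilde\lambda_i(u)$, then $\Omega=\widetilde\varphi(\widetilde\Omega)$ is singular of weights $-\widetilde\lambda_{4-i}(u)$, and $$\widetilde\varphi\big(\widetilde\Phi_{ab}(\bar u,\bar v)\big)=\Phi_{ba}(\bar v,\bar u).$$ -/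

import Mathlib

noncomputable section

open scoped HahnSeries

namespace SuperYangian

/-! ### Signs and gradings -/

/-- The sign `(-1)^x` of a parity `x`. -/
def sgn (x : ZMod 2) : ℤ := if x = 0 then 1 else -1

/-- The distinguished gradation of `gl(2|1)`: `[1] = [2] = 0`, `[3] = 1`. -/
def grad21 : Fin 3 → ZMod 2 := ![0, 0, 1]

/-- The distinguished gradation of `gl(1|2)`: `[1] = 0`, `[2] = [3] = 1`. -/
def grad12 : Fin 3 → ZMod 2 := ![0, 1, 1]

/-! ### The super-Yangian

`p : Fin N → ZMod 2` is the gradation.  The generator indexed by `(i, j, r)` is the mode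
`T_{ij}^{(r)}`, and `T_{ij}(u) = κ δ_{ij} + ∑_{r ≥ 0} T_{ij}^{(r)} (c / u)^{r + 1}`.
The value `κ = 1` is the usual super-Yangian. -/

/-- The coefficient of `(c / u)^r` in `T_{ij}(u)`, as an element of the free algebra. -/
def preMode {N : ℕ} (κ : ℂ) (i j : Fin N) : ℕ → FreeAlgebra ℂ (Fin N × Fin N × ℕ)
  | 0 => algebraMap ℂ _ (if i = j then κ else 0)
  | r + 1 => FreeAlgebra.ι ℂ (i, j, r)

/-- The graded commutator `x y - (-1)^{ab} y x` of elements `x`, `y` of parities `a`, `b`. -/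
def gcomm {A : Type*} [Ring A] (a b : ZMod 2) (x y : A) : A := x * y - sgn (a * b) • (y * x)

/-- The defining relations
`[T_{ij}(z), T_{kl}(w)} =
  (-1)^{[l]([i]+[j])+[i][j]} (c / (z - w)) (T_{il}(z) T_{kj}(w) - T_{il}(w) T_{kj}(z))`,
which are the entries of the `RTT` relation for the rational `R`-matrix `1 + c / (z - w) P`,
multiplied by `(z - w) / c` and compared at `(c / z)^r (c / w)^s`. -/
inductive Rel {N : ℕ} (p : Fin N → ZMod 2) (κ : ℂ) :
    FreeAlgebra ℂ (Fin N × Fin N × ℕ) → FreeAlgebra ℂ (Fin N × Fin N × ℕ) → Prop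
  | rtt (i j k l : Fin N) (r s : ℕ) : Rel p κ
      (gcomm (p i + p j) (p k + p l) (preMode κ i j (r + 1)) (preMode κ k l s)
        - gcomm (p i + p j) (p k + p l) (preMode κ i j r) (preMode κ k l (s + 1)))
      (sgn (p l * (p i + p j) + p i * p j) •
        (preMode κ i l r * preMode κ k j s - preMode κ i l s * preMode κ k j r))

end SuperYangian

open SuperYangian in
/-- The super-Yangian with gradation `p` whose monodromy matrix has leading term `κ` times the
identity matrix.  For `κ = 1` and `p` a distinguished gradation, this is `Y(gl(m|n))`. -/
def SuperYangian {N : ℕ} (p : Fin N → ZMod 2) (κ : ℂ) : Type := RingQuot (Rel p κ)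

namespace SuperYangian

instance {N : ℕ} (p : Fin N → ZMod 2) (κ : ℂ) : Ring (SuperYangian p κ) :=
  inferInstanceAs (Ring (RingQuot (Rel p κ)))

instance {N : ℕ} (p : Fin N → ZMod 2) (κ : ℂ) : Algebra ℂ (SuperYangian p κ) :=
  inferInstanceAs (Algebra ℂ (RingQuot (Rel p κ)))

/-- The quotient map from the free algebra. -/
def mk {N : ℕ} (p : Fin N → ZMod 2) (κ : ℂ) :
    FreeAlgebra ℂ (Fin N × Fin N × ℕ) →ₐ[ℂ] SuperYangian p κ := RingQuot.mkAlgHom ℂ (Rel p κ)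

/-- The coefficient of `(c / u)^r` in `T_{ij}(u)`: it is `κ δ_{ij}` for `r = 0`, and the
generator `T_{ij}^{(r - 1)}` for `r ≥ 1`. -/
def mode {N : ℕ} (p : Fin N → ZMod 2) (κ : ℂ) (i j : Fin N) (r : ℕ) : SuperYangian p κ :=
  mk p κ (preMode κ i j r)

theorem mode_zero {N : ℕ} (p : Fin N → ZMod 2) (κ : ℂ) (i j : Fin N) :
    mode p κ i j 0 = algebraMap ℂ _ (if i = j then κ else 0) := by
  simp only [mode, preMode, AlgHom.commutes]

theorem mode_rel {N : ℕ} (p : Fin N → ZMod 2) (κ : ℂ) (i j k l : Fin N) (r s : ℕ) :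
    gcomm (p i + p j) (p k + p l) (mode p κ i j (r + 1)) (mode p κ k l s)
        - gcomm (p i + p j) (p k + p l) (mode p κ i j r) (mode p κ k l (s + 1)) =
      sgn (p l * (p i + p j) + p i * p j) •
        (mode p κ i l r * mode p κ k j s - mode p κ i l s * mode p κ k j r) := by
  have h := RingQuot.mkAlgHom_rel ℂ (Rel.rtt (p := p) (κ := κ) i j k l r s)
  change mk p κ _ = mk p κ _ at h
  simpa only [gcomm, map_sub, map_mul, map_zsmul, mode] using h

/-- The algebra homomorphism out of the super-Yangian given by images `t i j r` of the modes
that satisfy the defining relations. -/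
def lift {N : ℕ} (p : Fin N → ZMod 2) (κ : ℂ) {A : Type*} [Ring A] [Algebra ℂ A]
    (t : Fin N → Fin N → ℕ → A)
    (h0 : ∀ i j, t i j 0 = algebraMap ℂ A (if i = j then κ else 0))
    (h : ∀ i j k l r s,
      gcomm (p i + p j) (p k + p l) (t i j (r + 1)) (t k l s)
        - gcomm (p i + p j) (p k + p l) (t i j r) (t k l (s + 1)) =
      sgn (p l * (p i + p j) + p i * p j) • (t i l r * t k j s - t i l s * t k j r)) :
    SuperYangian p κ →ₐ[ℂ] A :=
  RingQuot.liftAlgHom ℂ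
    ⟨FreeAlgebra.lift ℂ (fun x : Fin N × Fin N × ℕ => t x.1 x.2.1 (x.2.2 + 1)), by
      have hm : ∀ i j r, FreeAlgebra.lift ℂ
          (fun x : Fin N × Fin N × ℕ => t x.1 x.2.1 (x.2.2 + 1)) (preMode κ i j r) = t i j r := by
        intro i j r
        cases r with
        | zero => rw [h0]; simp only [preMode, AlgHom.commutes]
        | succ r => simp only [preMode, FreeAlgebra.lift_ι_apply]
      rintro _ _ ⟨i, j, k, l, r, s⟩
      simpa only [gcomm, map_sub, map_mul, map_zsmul, hm] using h i j k l r s⟩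

theorem lift_mode {N : ℕ} (p : Fin N → ZMod 2) (κ : ℂ) {A : Type*} [Ring A] [Algebra ℂ A]
    (t : Fin N → Fin N → ℕ → A) (h0) (h) (i j : Fin N) (r : ℕ) :
    lift p κ t h0 h (mode p κ i j r) = t i j r := by
  cases r with
  | zero => rw [mode_zero, AlgHom.commutes, h0]
  | succ r =>
    unfold lift mode mk
    erw [RingQuot.liftAlgHom_mkAlgHom_apply]
    simp only [preMode, FreeAlgebra.lift_ι_apply]

theorem hom_ext {N : ℕ} {p : Fin N → ZMod 2} {κ : ℂ} {A : Type*} [Ring A] [Algebra ℂ A]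
    {f g : SuperYangian p κ →ₐ[ℂ] A} (h : ∀ i j r, f (mode p κ i j r) = g (mode p κ i j r)) :
    f = g := by
  apply RingQuot.ringQuot_ext' ℂ
  apply FreeAlgebra.hom_ext
  funext ⟨i, j, r⟩
  exact h i j (r + 1)

theorem sgn_mul_self (x : ZMod 2) : sgn x * sgn x = 1 := by
  unfold sgn; split_ifs <;> rfl

/-- The parity automorphism `T_{ij}(u) ↦ (-1)^{[i]+[j]} T_{ij}(u)`. -/
def gr {N : ℕ} (p : Fin N → ZMod 2) (κ : ℂ) : SuperYangian p κ →ₐ[ℂ] SuperYangian p κ :=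
  lift p κ (fun i j r => sgn (p i + p j) • mode p κ i j r)
    (by
      intro i j
      rw [mode_zero]
      by_cases hij : i = j
      · subst hij; rw [CharTwo.add_self_eq_zero]; simp [sgn]
      · simp [hij])
    (by
      intro i j k l r s
      have h := mode_rel p κ i j k l r s
      have e : sgn (p i + p l) * sgn (p k + p j) = sgn (p i + p j) * sgn (p k + p l) := by
        generalize p i = a; generalize p j = b; generalize p k = c; generalize p l = d
        revert a b c d; decide
      simp only [gcomm, smul_mul_smul_comm] at h ⊢
      rw [e, mul_comm (sgn (p k + p l)) (sgn (p i + p j))]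
      linear_combination (norm := module) (sgn (p i + p j) * sgn (p k + p l)) • h)

/-- The homomorphism `T_{ij}(u) ↦ (-1)^{[i][j]+[j]+1} T'_{j̄ ī}(u)`, where `j̄ = N + 1 - j`,
to the super-Yangian with the opposite and shifted gradation `[j]' = [j̄] + 1`.  It changes the
sign of the leading term of the monodromy matrix. -/
def isoHom {N : ℕ} (p q : Fin N → ZMod 2) (hpq : ∀ j, q j = p j.rev + 1) (κ κ' : ℂ)
    (hκ : κ' = -κ) : SuperYangian p κ →ₐ[ℂ] SuperYangian q κ' :=
  lift p κ (fun i j r => sgn (p i * p j + p j + 1) • mode q κ' j.rev i.rev r)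
    (by
      intro i j
      rw [mode_zero, hκ]
      by_cases hij : i = j
      · subst hij
        have : p i * p i + p i + 1 = 1 := by
          generalize p i = a; revert a; decide
        rw [this]; simp [sgn]
      · have : j.rev ≠ i.rev := fun h => hij (Fin.rev_injective h).symm
        simp [hij, this])
    (by
      intro i j k l r s
      have h := mode_rel q κ' l.rev k.rev j.rev i.rev s r
      simp only [gcomm, smul_mul_smul_comm, hpq, Fin.rev_rev] at h ⊢
      generalize p i = a at *
      generalize p j = b at *
      generalize p k = c at *
      generalize p l = d at *
      generalize mode q κ' j.rev i.rev (r + 1) * mode q κ' l.rev k.rev s = x1 at *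
      generalize mode q κ' l.rev k.rev s * mode q κ' j.rev i.rev (r + 1) = x2 at *
      generalize mode q κ' j.rev i.rev r * mode q κ' l.rev k.rev (s + 1) = x3 at *
      generalize mode q κ' l.rev k.rev (s + 1) * mode q κ' j.rev i.rev r = x4 at *
      generalize mode q κ' l.rev i.rev s * mode q κ' j.rev k.rev r = x5 at *
      generalize mode q κ' l.rev i.rev r * mode q κ' j.rev k.rev s = x6 at *
      clear hpq hκ
      have cases2 : ∀ x : ZMod 2, x = 0 ∨ x = 1 := by decide
      have e11 : (1 : ZMod 2) + 1 = 0 := by decide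
      have e10 : (1 : ZMod 2) ≠ 0 := by decide
      rcases cases2 a with rfl | rfl <;> rcases cases2 b with rfl | rfl <;>
        rcases cases2 c with rfl | rfl <;> rcases cases2 d with rfl | rfl <;>
        simp only [sgn, e11, e10, add_zero, zero_add, mul_zero, mul_one, one_mul,
          if_true, if_false, one_smul, neg_smul, neg_neg] at h ⊢ <;>
        first
        | linear_combination (norm := module) h
        | linear_combination (norm := module) (-1 : ℤ) • h)

theorem isoHom_mode {N : ℕ} (p q : Fin N → ZMod 2) (hpq : ∀ j, q j = p j.rev + 1) (κ κ' : ℂ)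
    (hκ : κ' = -κ) (i j : Fin N) (r : ℕ) :
    isoHom p q hpq κ κ' hκ (mode p κ i j r) =
      sgn (p i * p j + p j + 1) • mode q κ' j.rev i.rev r :=
  lift_mode _ _ _ _ _ _ _ _

theorem isoHom_comp {N : ℕ} (p q : Fin N → ZMod 2) (hpq : ∀ j, q j = p j.rev + 1)
    (hqp : ∀ j, p j = q j.rev + 1) (κ κ' : ℂ) (hκ : κ' = -κ) (hκ' : κ = -κ') :
    (isoHom q p hqp κ' κ hκ').comp (isoHom p q hpq κ κ' hκ) = AlgHom.id ℂ _ := by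
  apply hom_ext
  intro i j r
  rw [AlgHom.comp_apply, isoHom_mode, map_zsmul, isoHom_mode, smul_smul, Fin.rev_rev, Fin.rev_rev,
    hpq, hpq, Fin.rev_rev, Fin.rev_rev]
  have : sgn (p i * p j + p j + 1) * sgn ((p j + 1) * (p i + 1) + (p i + 1) + 1) = 1 := by
    generalize p i = a; generalize p j = b
    revert a b; decide
  rw [this, one_smul, AlgHom.id_apply]

/-- The isomorphism `T_{ij}(u) ↦ (-1)^{[i][j]+[j]+1} T'_{j̄ ī}(u)`. -/
def iso {N : ℕ} (p q : Fin N → ZMod 2) (hpq : ∀ j, q j = p j.rev + 1)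
    (hqp : ∀ j, p j = q j.rev + 1) (κ : ℂ) : SuperYangian p κ ≃ₐ[ℂ] SuperYangian q (-κ) :=
  AlgEquiv.ofAlgHom (isoHom p q hpq κ (-κ) rfl) (isoHom q p hqp (-κ) κ (neg_neg κ).symm)
    (isoHom_comp q p hqp hpq _ _ _ _) (isoHom_comp p q hpq hqp _ _ _ _)

/-- The isomorphism `φ : Y(2|1) → Y(1|2)`. -/
def phi (κ : ℂ) : SuperYangian grad21 κ ≃ₐ[ℂ] SuperYangian grad12 (-κ) :=
  iso grad21 grad12 (by decide) (by decide) κ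

/-- The isomorphism `φ̃ : Y(1|2) → Y(2|1)`. -/
def phiTilde (κ : ℂ) : SuperYangian grad12 κ ≃ₐ[ℂ] SuperYangian grad21 (-κ) :=
  iso grad12 grad21 (by decide) (by decide) κ

/-- `Ω` is a singular vector: `T_{ii}(u) Ω = λ_i(u) Ω` and `T_{ij}(u) Ω = 0` for `i > j`, where
`λ_i(u) = ∑_r lam i r (c / u)^r`. -/
structure IsSingular {N : ℕ} (p : Fin N → ZMod 2) (κ : ℂ) {V : Type*} [AddCommGroup V]
    [Module (SuperYangian p κ) V] (Ω : V) (lam : Fin N → ℕ → ℂ) : Prop where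
  diag : ∀ i r, mode p κ i i r • Ω = algebraMap ℂ (SuperYangian p κ) (lam i r) • Ω
  lower : ∀ i j r, j < i → mode p κ i j r • Ω = 0

/-! ### The graded tensor product `End(ℂ^{m|n})^{⊗ n} ⊗ B`

`B` is a superalgebra over `K` with parity automorphism `γ` and structure map `ι : K → B`.  The
graded tensor product is realized as the ordinary algebra of matrices with index set
`Fin n → Fin N` and entries in `B`, through its action on `(K^{m|n})^{⊗ n} ⊗ B` with the sign rule
for exchanging odd objects:
`E_{ij}^{(q)}` sends `e_J` with `J q = j` to `(-1)^{([i]+[j]) ∑_{r<q} [J r]} e_{J'}`, where `J'` is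
`J` with `j` replaced by `i` in position `q`, and `1 ⊗ x` sends `e_I ⊗ 1` to
`(-1)^{[I][x]} e_I ⊗ x`. -/

section Auxiliary

variable {N n : ℕ} (p : Fin N → ZMod 2)

/-- The parity of the basis vector `e_I`. -/
def par (I : Fin n → Fin N) : ZMod 2 := ∑ q, p (I q)

/-- The elementary matrix `E_{ij}^{(q)}` in the `q`-th auxiliary space. -/
def elem (K : Type*) [Ring K] (q : Fin n) (i j : Fin N) :
    Matrix (Fin n → Fin N) (Fin n → Fin N) K :=
  Matrix.of fun I J =>
    if J q = j ∧ I = Function.update J q i then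
      ((sgn ((p i + p j) * ∑ r with r < q, p (J r)) : ℤ) : K)
    else 0

/-- The graded permutation `P_{qr} = ∑_{i,j} (-1)^{[j]} E_{ij}^{(q)} E_{ji}^{(r)}`. -/
def perm (K : Type*) [Ring K] (q r : Fin n) : Matrix (Fin n → Fin N) (Fin n → Fin N) K :=
  ∑ i, ∑ j, sgn (p j) • (elem p K q i j * elem p K r j i)

/-- The `R`-matrix `R_{qr}(x, y) = 1 + g(x, y) P_{qr}` with `g(x, y) = c / (x - y)`. -/
def rMat {K : Type*} [Field K] (c : K) (q r : Fin n) (x y : K) :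
    Matrix (Fin n → Fin N) (Fin n → Fin N) K :=
  1 + (c / (x - y)) • perm p K q r

/-- `γ` raised to a parity, applied to `x`. -/
def twist {B : Type*} (γ : B → B) (a : ZMod 2) (x : B) : B := if a = 0 then x else γ x

/-- The element `1 ⊗ x`. -/
def inB {B : Type*} [Ring B] (γ : B → B) (x : B) : Matrix (Fin n → Fin N) (Fin n → Fin N) B :=
  Matrix.diagonal fun I => twist γ (par p I) x

/-- The monodromy matrix `T_q = ∑_{i,j} E_{ij}^{(q)} ⊗ T_{ij}` in the `q`-th auxiliary space. -/
def tMat {B : Type*} [Ring B] (γ : B → B) (q : Fin n) (T : Fin N → Fin N → B) :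
    Matrix (Fin n → Fin N) (Fin n → Fin N) B :=
  ∑ i, ∑ j, elem p B q i j * inB p γ (T i j)

/-- The super-trace over all auxiliary spaces, `str (E_{IJ} ⊗ x) = (-1)^{[I]} δ_{IJ} x`; the element
`E_{II} ⊗ x` is the matrix whose only entry is `γ^{[I]} x`, at `(I, I)`. -/
def superTrace {B : Type*} [Ring B] (γ : B → B) (X : Matrix (Fin n → Fin N) (Fin n → Fin N) B) : B :=
  ∑ I, sgn (par p I) • twist γ (par p I) (X I I)

end Auxiliary

/-- `H(w) = ∏_{k<j} h(w_j, w_k)` with `h(x, y) = (x - y + c) / c`. -/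
def hProd {K : Type*} [Field K] (c : K) {b : ℕ} (w : Fin b → K) : K :=
  ∏ k, ∏ j with k < j, (w j - w k + c) / c

/-- The product `(R_{a+1,a} ⋯ R_{a+1,1}) (R_{a+2,a} ⋯ R_{a+2,1}) ⋯ (R_{a+b,a} ⋯ R_{a+b,1})`, where
`R_{a+j,k} = R_{a+j,k}(v_j, u_k)`. -/
def rProd {N : ℕ} (p : Fin N → ZMod 2) {K : Type*} [Field K] (c : K) {a b : ℕ}
    (u : Fin a → K) (v : Fin b → K) :
    Matrix (Fin (a + b) → Fin N) (Fin (a + b) → Fin N) K :=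
  (List.ofFn fun j : Fin b => (List.ofFn fun k : Fin a =>
    rMat p c (Fin.natAdd a j) (Fin.castAdd b k.rev) (v j) (u k.rev)).prod).prod

/-- The super-trace
`str_{1⋯a+b} [T_1(u_1) ⋯ T_a(u_a) T_{a+1}(v_1) ⋯ T_{a+b}(v_b) R_{1⋯a+b}
  E_{21}^{(1)} ⋯ E_{21}^{(a)} E_{32}^{(a+1)} ⋯ E_{32}^{(a+b)}]`. -/
def betheTrace (p : Fin 3 → ZMod 2) {K B : Type*} [Field K] [Ring B] (ι : K → B) (γ : B → B)
    (c : K) (T : K → Fin 3 → Fin 3 → B) {a b : ℕ} (u : Fin a → K) (v : Fin b → K) : B :=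
  superTrace p γ
    ((List.ofFn fun k : Fin a => tMat p γ (Fin.castAdd b k) (T (u k))).prod *
      (List.ofFn fun j : Fin b => tMat p γ (Fin.natAdd a j) (T (v j))).prod *
      (rProd p c u v *
        (List.ofFn fun k : Fin a => elem p K (Fin.castAdd b k) 1 0).prod *
        (List.ofFn fun j : Fin b => elem p K (Fin.natAdd a j) 2 1).prod).map ι)

/-! ### Bethe vectors

The spectral parameters are elements of negative order of a field `K = ℂ⟦Γ⟧` of Hahn series.  If `V`
is a module over the super-Yangian `Y`, then `Y⟦Γ⟧` acts on `V⟦Γ⟧`, and `T_{ij}(u) ∈ Y⟦Γ⟧`. -/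

section Bethe

variable {Γ : Type*} [AddCommGroup Γ] [LinearOrder Γ] [IsOrderedAddMonoid Γ]

/-- The family of the terms `x^r t_r`, `r ∈ ℕ`, which is summable if `x` has positive order. -/
def termFamily {A : Type*} [Ring A] [Algebra ℂ A] (t : ℕ → A) (x : ℂ⟦Γ⟧) :
    HahnSeries.SummableFamily Γ A ℕ where
  toFun r := (HahnSeries.SummableFamily.powers x r).map (LinearMap.toSpanSingleton ℂ A (t r))
  isPWO_iUnion_support' := by
    refine (HahnSeries.SummableFamily.powers x).isPWO_iUnion_support.mono ?_
    refine Set.iUnion_mono fun r g hg h0 => hg ?_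
    simp only [HahnSeries.map_coeff, h0, map_zero]
  finite_co_support' g := by
    refine ((HahnSeries.SummableFamily.powers x).finite_co_support g).subset fun r hg h0 => hg ?_
    simp only [HahnSeries.map_coeff, h0, map_zero]

/-- The series `T_{ij}(u) = ∑_r mode i j r (c / u)^r`, for `u` of negative order. -/
def monodromy {N : ℕ} (p : Fin N → ZMod 2) (κ c : ℂ) (u : ℂ⟦Γ⟧) (i j : Fin N) :
    (SuperYangian p κ)⟦Γ⟧ :=
  (termFamily (mode p κ i j) (HahnSeries.C c * u⁻¹)).hsum

/-- `betheTrace` for the universal monodromy matrix of the super-Yangian. -/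
def yangianTrace (p : Fin 3 → ZMod 2) (κ c : ℂ) {a b : ℕ} (u : Fin a → ℂ⟦Γ⟧) (v : Fin b → ℂ⟦Γ⟧) :
    (SuperYangian p κ)⟦Γ⟧ :=
  betheTrace p (fun x => x.map (algebraMap ℂ (SuperYangian p κ))) (fun x => x.map (gr p κ))
    (HahnSeries.C c) (monodromy p κ c) u v

/-- The vector `s x Ω` for a scalar `s ∈ K` and an element `x ∈ Y⟦Γ⟧`. -/
def applyTo {Y V : Type*} [Ring Y] [Algebra ℂ Y] [AddCommGroup V] [Module Y V] (s : ℂ⟦Γ⟧)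
    (x : Y⟦Γ⟧) (Ω : V) : V⟦Γ⟧ :=
  (HahnModule.of Y).symm
    ((s.map (algebraMap ℂ Y) * x) • HahnModule.of Y (HahnSeries.single (0 : Γ) Ω))

/-- The `Y(2|1)` Bethe vector `Φ_{ab}(u, v)`, normalized by `(-1)^b / H(v)`. -/
def bethe21 (κ c : ℂ) {V : Type*} [AddCommGroup V] [Module (SuperYangian grad21 κ) V] {a b : ℕ}
    (u : Fin a → ℂ⟦Γ⟧) (v : Fin b → ℂ⟦Γ⟧) (Ω : V) : V⟦Γ⟧ :=
  applyTo ((-1) ^ b / hProd (HahnSeries.C c) v) (yangianTrace grad21 κ c u v) Ω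

/-- The `Y(1|2)` Bethe vector `Φ̃_{ab}(u, v)`, normalized by `(-1)^a / H(u)`. -/
def bethe12 (κ c : ℂ) {V : Type*} [AddCommGroup V] [Module (SuperYangian grad12 κ) V] {a b : ℕ}
    (u : Fin a → ℂ⟦Γ⟧) (v : Fin b → ℂ⟦Γ⟧) (Ω : V) : V⟦Γ⟧ :=
  applyTo ((-1) ^ a / hProd (HahnSeries.C c) u) (yangianTrace grad12 κ c u v) Ω

end Bethe

end SuperYangian

end

noncomputable section

open scoped HahnSeries

namespace SuperYangian

/-! The isomorphism is a homomorphism of algebras, yet it replaces the index pair `(i, j)` by `(j̄,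
ī)`. So on a monodromy matrix it acts as a super-transposition in the auxiliary space, combined with
reversal of the basis, and it leaves the order of the operators `T(u_1) T(u_2) ⋯` unchanged. Hence
applying it to `str (T_1 ⋯ T_n C)`, with `C` a scalar matrix, amounts to replacing `T` by `T'` and
`C` by its transpose (`map_superTrace_tMat_prod_mul`).

The trace for `(u, v)` must first be given the operator order of the trace for `(v, u)`. The RTT
relation gives `T(u) T(v) ℝ = ℝ T(v) T(u)` for the two groups of monodromy matrices
(`tMat_prod_mul_rProd`). As `ℝ` is even and scalar, cyclicity of the super-trace carries it to the
far right (`superTrace_mul_comm`), and a graded flip of the two groups of auxiliary spaces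
(`relabel`) puts those of `v` in front. The scalar matrix is then `C = E_21 ⋯ E_32 ⋯ ℝ`.

Transposition `superT` reverses products up to sign (`superT_mul`), exchanges `E_21` with `E_32`,
and sends `P` to `-P` because the gradation is shifted by one. Thus `R(x, y)` becomes `R(y, x)`, and
the transpose of `C` is `ℝ' E_21 ⋯ E_32 ⋯` with the roles of `u` and `v` exchanged
(`map_betheTrace`). The prefactor of the Bethe vector is literally the same on both sides.

Two points carry the bookkeeping. The signs reduce to polynomial identities over `ZMod 2`, centred
on `transposeSign_add` and `monodromySign_rev`. The mode relations are summed into an exchange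
relation of Hahn series in `monodromy_exchange`. -/

theorem sgn_add (x y : ZMod 2) : sgn (x + y) = sgn x * sgn y := by
  revert x y; decide

theorem sgn_zero : sgn 0 = 1 := rfl

theorem sgn_smul_sgn_smul {M : Type*} [AddCommGroup M] (x y : ZMod 2) (m : M) :
    sgn x • sgn y • m = sgn (x + y) • m := by
  rw [sgn_add, mul_smul]

theorem add_self (x : ZMod 2) : x + x = 0 := CharTwo.add_self_eq_zero x

/-! ### Elementary matrices in the graded tensor product -/

section Elementary

variable {N n : ℕ} (p : Fin N → ZMod 2)

theorem sum_lt_update_of_le {q s : Fin n} (h : q ≤ s) (J : Fin n → Fin N) (i : Fin N) :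
    ∑ r with r < q, p (Function.update J s i r) = ∑ r with r < q, p (J r) := by
  refine Finset.sum_congr rfl fun r hr => ?_
  rw [Function.update_of_ne]
  have := (Finset.mem_filter.1 hr).2
  omega

theorem sum_update (S : Finset (Fin n)) {s : Fin n} (h : s ∈ S) (J : Fin n → Fin N) (i : Fin N) :
    ∑ r ∈ S, p (Function.update J s i r) = ∑ r ∈ S, p (J r) + (p (J s) + p i) := by
  rw [← Finset.add_sum_erase S _ h, ← Finset.add_sum_erase S (fun r => p (J r)) h,
    Function.update_self, Finset.sum_congr rfl fun r hr => by
      rw [Function.update_of_ne (Finset.ne_of_mem_erase hr)]]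
  linear_combination -(add_self (p (J s)))

theorem par_update (J : Fin n → Fin N) (s : Fin n) (i : Fin N) :
    par p (Function.update J s i) = par p J + (p (J s) + p i) :=
  sum_update p _ (Finset.mem_univ s) J i

variable {B : Type*} [Ring B]

theorem mul_elem_apply (M : Matrix (Fin n → Fin N) (Fin n → Fin N) B) (r : Fin n) (k l : Fin N)
    (I J : Fin n → Fin N) :
    (M * elem p B r k l) I J = if J r = l then
      sgn ((p k + p l) * ∑ s with s < r, p (J s)) • M I (Function.update J r k) else 0 := by
  rw [Matrix.mul_apply]
  split_ifs with h
  · rw [Finset.sum_eq_single (Function.update J r k)]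
    · simp only [elem, Matrix.of_apply, h, and_self, if_true]
      rw [zsmul_eq_mul, Int.cast_comm]
    · intro K _ hK
      simp [elem, hK]
    · simp
  · exact Finset.sum_eq_zero fun K _ => by simp [elem, h]

theorem elem_apply (q : Fin n) (i j : Fin N) (I J : Fin n → Fin N) :
    elem p B q i j I J = if J q = j then sgn ((p i + p j) * ∑ r with r < q, p (J r)) •
      (if I = Function.update J q i then (1 : B) else 0) else 0 := by
  simp only [elem, Matrix.of_apply]
  split_ifs <;> simp_all

theorem elem_mul_elem_same (q : Fin n) (i j k l : Fin N) :
    elem p B q i j * elem p B q k l = if j = k then elem p B q i l else 0 := by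
  ext I J
  rw [mul_elem_apply, elem_apply, Function.update_self, sum_lt_update_of_le p le_rfl,
    Function.update_idem]
  by_cases hjk : j = k
  · subst hjk
    rw [if_pos rfl, if_pos rfl, elem_apply, sgn_smul_sgn_smul]
    congr 3
    linear_combination p j * (∑ r with r < q, p (J r)) * CharTwo.two_eq_zero (R := ZMod 2)
  · simp [hjk, Ne.symm hjk]

/-- For `q < r` the replacement at `q` changes the prefix parity seen at `r` by `[i] + [j]`, while
the prefix seen at `q` ignores the position `r`. This is the whole sign. -/
theorem elem_comm_of_lt {q r : Fin n} (h : q < r) (i j k l : Fin N) :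
    elem p B q i j * elem p B r k l =
      sgn ((p i + p j) * (p k + p l)) • (elem p B r k l * elem p B q i j) := by
  ext I J
  rw [Matrix.smul_apply, mul_elem_apply, mul_elem_apply, elem_apply, elem_apply,
    Function.update_of_ne h.ne, Function.update_of_ne h.ne', sum_lt_update_of_le p h.le,
    sum_update p _ (by simpa using h), Function.update_comm h.ne]
  by_cases hr : J r = l <;> by_cases hq : J q = j <;> simp only [hr, hq, if_true, if_false,
    smul_zero]
  rw [sgn_smul_sgn_smul, sgn_smul_sgn_smul, sgn_smul_sgn_smul]
  congr 2
  linear_combination -(p k + p l) * (p i + p j) * CharTwo.two_eq_zero (R := ZMod 2)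

theorem elem_comm {q r : Fin n} (h : q ≠ r) (i j k l : Fin N) :
    elem p B q i j * elem p B r k l =
      sgn ((p i + p j) * (p k + p l)) • (elem p B r k l * elem p B q i j) := by
  rcases lt_or_gt_of_ne h with h | h
  · exact elem_comm_of_lt p h i j k l
  · rw [elem_comm_of_lt p h, sgn_smul_sgn_smul, mul_comm, add_self, sgn_zero, one_smul]

variable (γ : B →+* B)

theorem twist_of_homogeneous {x : B} {a : ZMod 2} (hx : γ x = sgn a • x) (b : ZMod 2) :
    twist γ b x = sgn (b * a) • x := by
  have : ∀ b : ZMod 2, b = 0 ∨ b = 1 := by decide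
  rcases this b with rfl | rfl
  · simp [twist, sgn]
  · simp [twist, hx]

theorem twist_sum {ι : Type*} (b : ZMod 2) (S : Finset ι) (f : ι → B) :
    twist γ b (∑ i ∈ S, f i) = ∑ i ∈ S, twist γ b (f i) := by
  unfold twist; split_ifs <;> simp

theorem inB_mul (x y : B) :
    inB (n := n) p γ x * inB p γ y = inB p γ (x * y) := by
  simp only [inB, Matrix.diagonal_mul_diagonal, twist]
  congr 1; ext I; split_ifs <;> simp

/-- Replacing `j` by `i` shifts the parity of the basis vector by `[i] + [j]`, so the twist of `x`
changes by exactly the Koszul sign. -/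
theorem inB_mul_elem {x : B} {a : ZMod 2} (hx : γ x = sgn a • x) (q : Fin n) (i j : Fin N) :
    inB p γ x * elem p B q i j = sgn ((p i + p j) * a) • (elem p B q i j * inB p γ x) := by
  ext I J
  rw [Matrix.smul_apply, mul_elem_apply, inB, Matrix.mul_diagonal, elem_apply]
  by_cases h : J q = j
  · simp only [h, if_true, Matrix.diagonal_apply, twist_of_homogeneous γ hx]
    by_cases hI : I = Function.update J q i
    · subst hI
      simp only [if_true, smul_mul_assoc, mul_smul_comm, one_mul, sgn_smul_sgn_smul, par_update, h]
      congr 2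
      ring
    · simp [hI]
  · simp [h]

end Elementary

/-! ### Reindexing of fourfold sums -/

section Sums

variable {ι M : Type*} [Fintype ι] [AddCommMonoid M]

theorem sum_pairs_comm (f : ι → ι → ι → ι → M) :
    ∑ i, ∑ j, ∑ k, ∑ l, f i j k l = ∑ k, ∑ l, ∑ i, ∑ j, f i j k l := by
  have := Finset.sum_comm (s := (Finset.univ : Finset (ι × ι))) (t := (Finset.univ : Finset (ι × ι)))
    (f := fun x y => f x.1 x.2 y.1 y.2)
  simpa only [Fintype.sum_prod_type] using this

theorem sum_swap_first_third (f : ι → ι → ι → ι → M) :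
    ∑ i, ∑ j, ∑ k, ∑ l, f i j k l = ∑ i, ∑ j, ∑ k, ∑ l, f k j i l := by
  have (i : ι) : ∑ j, ∑ k, ∑ l, f i j k l = ∑ k, ∑ j, ∑ l, f i j k l := Finset.sum_comm
  simp only [this]
  rw [Finset.sum_comm]
  exact Finset.sum_congr rfl fun k _ => Finset.sum_comm

theorem sum_swap_second_fourth (f : ι → ι → ι → ι → M) :
    ∑ i, ∑ j, ∑ k, ∑ l, f i j k l = ∑ i, ∑ j, ∑ k, ∑ l, f i l k j := by
  rw [sum_pairs_comm, sum_swap_first_third, sum_pairs_comm]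

end Sums

/-! ### Graded permutations and the matrix form of the RTT relation -/

section Exchange

variable {N n : ℕ} (p : Fin N → ZMod 2) {B : Type*} [Ring B]

theorem perm_mul_elem_mul_elem {q r : Fin n} (h : q ≠ r) (i j k l : Fin N) :
    perm p B q r * (elem p B q i j * elem p B r k l) =
      sgn (p i + (p k + p i) * (p i + p j)) • (elem p B q k j * elem p B r i l) := by
  have key : ∀ a b, sgn (p b) • (elem p B q a b * elem p B r b a) *
      (elem p B q i j * elem p B r k l) = if b = i then if a = k then
        sgn (p i + (p k + p i) * (p i + p j)) • (elem p B q k j * elem p B r i l) else 0 else 0 := by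
    intro a b
    rw [smul_mul_assoc, mul_assoc, ← mul_assoc (elem p B r b a), elem_comm p h.symm, smul_mul_assoc,
      mul_smul_comm, mul_assoc, ← mul_assoc, elem_mul_elem_same, elem_mul_elem_same,
      sgn_smul_sgn_smul]
    by_cases hb : b = i
    · by_cases ha : a = k
      · subst hb ha
        simp only [if_true]
        congr 2
        ring
      · simp [ha]
    · simp [hb]
  simp only [perm, Finset.sum_mul, key, Finset.sum_ite_eq', Finset.mem_univ, if_true]

theorem elem_mul_elem_mul_perm {q r : Fin n} (h : q ≠ r) (i j k l : Fin N) :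
    elem p B q i j * elem p B r k l * perm p B q r =
      sgn (p l + (p k + p l) * (p j + p l)) • (elem p B q i l * elem p B r k j) := by
  have key : ∀ a b, elem p B q i j * elem p B r k l *
      sgn (p b) • (elem p B q a b * elem p B r b a) = if b = l then if a = j then
        sgn (p l + (p k + p l) * (p j + p l)) • (elem p B q i l * elem p B r k j) else 0 else 0 := by
    intro a b
    rw [mul_smul_comm, mul_assoc, ← mul_assoc (elem p B r k l), elem_comm p h.symm, smul_mul_assoc,
      mul_smul_comm, mul_assoc, ← mul_assoc, elem_mul_elem_same, elem_mul_elem_same,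
      sgn_smul_sgn_smul]
    by_cases hb : b = l
    · by_cases ha : a = j
      · subst hb ha
        simp only [if_true]
      · simp [ha, Ne.symm ha]
    · simp [hb, Ne.symm hb]
  simp only [perm, Finset.mul_sum, key, Finset.sum_ite_eq', Finset.mem_univ, if_true]

/-- The two elementary matrices in a summand of `perm` have equal parity, so the two signs produced
by passing them cancel. The same reason gives `perm_commute_inB`. -/
theorem perm_commute_elem {q r s : Fin n} (hq : s ≠ q) (hr : s ≠ r) (k l : Fin N) :
    Commute (perm p B q r) (elem p B s k l) := by
  refine Commute.sum_left _ _ _ fun i _ => Commute.sum_left _ _ _ fun j _ => ?_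
  refine Commute.smul_left ?_ _
  rw [commute_iff_eq, mul_assoc, elem_comm p hr.symm, mul_smul_comm, ← mul_assoc,
    elem_comm p hq.symm, smul_mul_assoc, sgn_smul_sgn_smul, mul_assoc, add_comm (p j), add_self,
    sgn_zero, one_smul]

theorem perm_commute_perm {q r s t : Fin n} (hqs : s ≠ q) (hrs : s ≠ r) (hqt : t ≠ q)
    (hrt : t ≠ r) : Commute (perm p B q r) (perm p B s t) := by
  refine Commute.sum_right _ _ _ fun i _ => Commute.sum_right _ _ _ fun j _ => ?_
  exact Commute.smul_right
    ((perm_commute_elem p hqs hrs i j).mul_right (perm_commute_elem p hqt hrt j i)) _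

theorem perm_symm {q r : Fin n} (h : q ≠ r) : perm p B q r = perm p B r q := by
  unfold perm
  rw [Finset.sum_comm]
  refine Finset.sum_congr rfl fun i _ => Finset.sum_congr rfl fun j _ => ?_
  rw [elem_comm p h, sgn_smul_sgn_smul]
  congr 2
  generalize p i = x; generalize p j = y; revert x y; decide

variable (γ : B →+* B)

/-- The entries `T_{ij}` are homogeneous of parity `[i] + [j]`. -/
def IsGraded (T : Fin N → Fin N → B) : Prop := ∀ i j, γ (T i j) = sgn (p i + p j) • T i j

theorem perm_commute_inB (q r : Fin n) {x : B} {a : ZMod 2}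
    (hx : γ x = sgn a • x) : Commute (perm p B q r) (inB p γ x) := by
  refine Commute.sum_left _ _ _ fun i _ => Commute.sum_left _ _ _ fun j _ => ?_
  refine Commute.smul_left ?_ _
  rw [commute_iff_eq, ← mul_assoc (inB p γ x), inB_mul_elem p γ hx, smul_mul_assoc,
    mul_assoc _ (inB p γ x), inB_mul_elem p γ hx, mul_smul_comm, ← mul_assoc, sgn_smul_sgn_smul, mul_assoc, add_comm (p j), add_self,
    sgn_zero, one_smul]

theorem perm_commute_tMat {q r s : Fin n} (hq : s ≠ q) (hr : s ≠ r) {T : Fin N → Fin N → B}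
    (hT : IsGraded p γ T) : Commute (perm p B q r) (tMat p γ s T) :=
  Commute.sum_right _ _ _ fun i _ => Commute.sum_right _ _ _ fun j _ =>
    (perm_commute_elem p hq hr i j).mul_right (perm_commute_inB p γ q r (hT i j))

theorem tMat_mul_tMat {q r : Fin n} {X Y : Fin N → Fin N → B} (hX : IsGraded p γ X) :
    tMat p γ q X * tMat p γ r Y = ∑ i, ∑ j, ∑ k, ∑ l,
      sgn ((p k + p l) * (p i + p j)) •
        (elem p B q i j * elem p B r k l * inB p γ (X i j * Y k l)) := by
  simp only [tMat, Finset.sum_mul]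
  simp only [Finset.mul_sum]
  refine Finset.sum_congr rfl fun i _ => Finset.sum_congr rfl fun j _ =>
    Finset.sum_congr rfl fun k _ => Finset.sum_congr rfl fun l _ => ?_
  rw [mul_assoc, ← mul_assoc (inB p γ _), inB_mul_elem p γ (hX i j), smul_mul_assoc, mul_smul_comm,
    mul_assoc, inB_mul, mul_assoc]

theorem tMat_mul_tMat_rev {q r : Fin n} (h : q ≠ r) {X Y : Fin N → Fin N → B}
    (hY : IsGraded p γ Y) :
    tMat p γ r Y * tMat p γ q X = ∑ i, ∑ j, ∑ k, ∑ l,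
        (elem p B q i j * elem p B r k l * inB p γ (Y k l * X i j)) := by
  rw [tMat_mul_tMat p γ hY, sum_pairs_comm]
  refine Finset.sum_congr rfl fun i _ => Finset.sum_congr rfl fun j _ =>
    Finset.sum_congr rfl fun k _ => Finset.sum_congr rfl fun l _ => ?_
  rw [elem_comm p h, smul_mul_assoc]

variable {K : Type*} [CommRing K] [Algebra K B]

/-- The exchange relation of `X = T(z)` and `Y = T(w)`, where `g = g(z, w)`. -/
def ExchangeRel (g : K) (X Y : Fin N → Fin N → B) : Prop := ∀ i j k l,
  gcomm (p i + p j) (p k + p l) (X i j) (Y k l) =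
    sgn (p l * (p i + p j) + p i * p j) • g • (X i l * Y k j - Y i l * X k j)

theorem smul_inB (g : K) (hγ : ∀ k : K, γ (algebraMap K B k) = algebraMap K B k) (x : B) :
    inB (n := n) p γ (g • x) = g • inB p γ x := by
  ext I J
  by_cases h : I = J <;> simp [inB, twist, h, Algebra.smul_def, hγ]

theorem zsmul_inB (g : ℤ) (x : B) :
    inB (n := n) p γ (g • x) = g • inB p γ x := by
  ext I J
  by_cases h : I = J <;> simp [inB, twist, h]

theorem inB_sub (x y : B) :
    inB (n := n) p γ (x - y) = inB p γ x - inB p γ y := by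
  ext I J
  by_cases h : I = J <;> simp [inB, twist, h]
  split_ifs <;> simp

/-- Both sides are expanded over the products `E_ij E_kl`. Multiplication by `P` on the left swaps
the row indices `i, k`, and on the right the column indices `j, l`; after reindexing, each
coefficient is one instance of the exchange relation, that of `Y k l` with `X i j`. -/
theorem rtt {q r : Fin n} (h : q ≠ r) (hγ : ∀ k : K, γ (algebraMap K B k) = algebraMap K B k)
    {X Y : Fin N → Fin N → B}
    (hX : IsGraded p γ X) (hY : IsGraded p γ Y) {g : K} (hXY : ExchangeRel p (-g) Y X) :
    (1 + g • perm p B q r) * (tMat p γ q X * tMat p γ r Y) =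
      tMat p γ r Y * tMat p γ q X * (1 + g • perm p B q r) := by
  have h1 : perm p B q r * (tMat p γ q X * tMat p γ r Y) = ∑ i, ∑ j, ∑ k, ∑ l,
      sgn (p j * (p k + p l) + p k * p l) •
        (elem p B q i j * elem p B r k l * inB p γ (X k j * Y i l)) := by
    rw [tMat_mul_tMat p γ hX, sum_swap_first_third]
    simp only [Finset.mul_sum]
    refine Finset.sum_congr rfl fun i _ => Finset.sum_congr rfl fun j _ =>
      Finset.sum_congr rfl fun k _ => Finset.sum_congr rfl fun l _ => ?_
    rw [mul_smul_comm, ← mul_assoc, perm_mul_elem_mul_elem p h, smul_mul_assoc, sgn_smul_sgn_smul]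
    congr 2
    generalize p i = a; generalize p j = b; generalize p k = c; generalize p l = d
    revert a b c d; decide
  have h2 : tMat p γ r Y * tMat p γ q X * perm p B q r = ∑ i, ∑ j, ∑ k, ∑ l,
      sgn (p j * (p k + p l) + p k * p l) •
        (elem p B q i j * elem p B r k l * inB p γ (Y k j * X i l)) := by
    rw [tMat_mul_tMat_rev p γ h hY, sum_swap_second_fourth]
    simp only [Finset.sum_mul]
    refine Finset.sum_congr rfl fun i _ => Finset.sum_congr rfl fun j _ =>
      Finset.sum_congr rfl fun k _ => Finset.sum_congr rfl fun l _ => ?_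
    have hg : γ (Y k j * X i l) = sgn (p k + p j + (p i + p l)) • (Y k j * X i l) := by
      have h1 := hX i l
      have h2 := hY k j
      simp only [map_mul] at h1 h2 ⊢
      rw [h1, h2, smul_mul_smul_comm, sgn_add (p k + p j)]
    rw [mul_assoc, ← (perm_commute_inB p γ q r hg).eq, ← mul_assoc,
      elem_mul_elem_mul_perm p h, smul_mul_assoc]
    congr 2
    generalize p j = b; generalize p k = c; generalize p l = d
    revert b c d; decide
  have h0 : tMat p γ q X * tMat p γ r Y = _ := tMat_mul_tMat p γ hX
  have h0' : tMat p γ r Y * tMat p γ q X = _ := tMat_mul_tMat_rev p γ h hY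
  rw [add_mul, mul_add, one_mul, mul_one, smul_mul_assoc, mul_smul_comm, h1, h2, h0, h0',
    ← sub_eq_zero]
  simp only [Finset.smul_sum, ← Finset.sum_add_distrib, ← Finset.sum_sub_distrib]
  refine Finset.sum_eq_zero fun i _ => Finset.sum_eq_zero fun j _ =>
    Finset.sum_eq_zero fun k _ => Finset.sum_eq_zero fun l _ => ?_
  have := congrArg (fun x => elem p B q i j * elem p B r k l * inB p γ x) (hXY k l i j)
  simp only [gcomm] at this
  rw [inB_sub, zsmul_inB, zsmul_inB, smul_inB p γ _ hγ, inB_sub] at this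
  simp only [mul_sub, mul_smul_comm] at this
  linear_combination (norm := module) -this

end Exchange

/-! ### Ordered products and intertwiners in a monoid -/

section Products

variable {M : Type*} [Monoid M]

theorem commute_prod_ofFn {n : ℕ} {x : M} {f : Fin n → M} (h : ∀ k, Commute x (f k)) :
    Commute x (List.ofFn f).prod := by
  refine Commute.list_prod_right _ _ fun y hy => ?_
  obtain ⟨k, rfl⟩ := (List.mem_ofFn' f y).1 hy
  exact h k

theorem prod_ofFn_rev_succ {n : ℕ} (f : Fin (n + 1) → M) :
    (List.ofFn fun k => f k.rev).prod = (List.ofFn fun k => f k.rev.succ).prod * f 0 := by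
  rw [List.ofFn_succ', List.prod_concat, Fin.rev_last]
  simp only [Fin.rev_castSucc]

theorem prod_ofFn_succ {n : ℕ} (f : Fin (n + 1) → M) :
    (List.ofFn f).prod = f 0 * (List.ofFn fun k => f k.succ).prod := by
  rw [List.ofFn_succ, List.prod_cons]

/-- Moving `y` through `x_1 ⋯ x_a` with the help of intertwiners. -/
theorem prod_mul_mul_prod_rev {a : ℕ} (x r : Fin a → M) (y : M)
    (h : ∀ k, r k * (y * x k) = x k * y * r k) (hc : ∀ k l, k ≠ l → Commute (r k) (x l)) :
    (List.ofFn x).prod * y * (List.ofFn fun k => r k.rev).prod =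
      (List.ofFn fun k => r k.rev).prod * (y * (List.ofFn x).prod) := by
  induction a with
  | zero => simp
  | succ a ih =>
    have ih' := ih (fun k => x k.succ) (fun k => r k.succ) (fun k => h _)
      (fun k l hkl => hc _ _ (by simpa using hkl))
    have c1 : Commute (x 0) (List.ofFn fun k => r k.rev.succ).prod :=
      commute_prod_ofFn fun k => (hc _ _ (Fin.succ_ne_zero _)).symm
    have c2 : Commute (r 0) (List.ofFn fun k => x k.succ).prod :=
      commute_prod_ofFn fun k => hc _ _ (Fin.succ_ne_zero _).symm
    rw [prod_ofFn_rev_succ, prod_ofFn_succ]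
    generalize (List.ofFn fun k => x k.succ).prod = X at *
    generalize (List.ofFn fun k => r k.rev.succ).prod = R at *
    calc x 0 * X * y * (R * r 0) = x 0 * (X * y * R) * r 0 := by simp only [mul_assoc]
      _ = (x 0 * R) * y * (X * r 0) := by rw [ih']; simp only [mul_assoc]
      _ = R * (x 0 * y * r 0) * X := by rw [c1.eq, c2.symm.eq]; simp only [mul_assoc]
      _ = _ := by rw [← h]; simp only [mul_assoc]

/-- Used with `z` the product of all `T(u_k)`, `y j = T(v_j)`, and `r j` the row of `R`-matrices
attached to `v_j`, for which the hypothesis is supplied by `prod_mul_mul_prod_rev`. -/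
theorem mul_prod_mul_prod {b : ℕ} (z : M) (y r : Fin b → M)
    (h : ∀ k, z * y k * r k = r k * (y k * z)) (hc : ∀ k l, k ≠ l → Commute (r k) (y l)) :
    z * (List.ofFn y).prod * (List.ofFn r).prod =
      (List.ofFn r).prod * ((List.ofFn y).prod * z) := by
  induction b with
  | zero => simp
  | succ b ih =>
    have ih' := ih (fun k => y k.succ) (fun k => r k.succ) (fun k => h _)
      (fun k l hkl => hc _ _ (by simpa using hkl))
    have c1 : Commute (y 0) (List.ofFn fun k => r k.succ).prod :=
      commute_prod_ofFn fun k => (hc _ _ (Fin.succ_ne_zero _)).symm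
    have c2 : Commute (r 0) (List.ofFn fun k => y k.succ).prod :=
      commute_prod_ofFn fun k => hc _ _ (Fin.succ_ne_zero _).symm
    rw [prod_ofFn_succ, prod_ofFn_succ r]
    generalize (List.ofFn fun k => y k.succ).prod = Y at *
    generalize (List.ofFn fun k => r k.succ).prod = R at *
    calc z * (y 0 * Y) * (r 0 * R) = z * y 0 * (Y * r 0) * R := by simp only [mul_assoc]
      _ = (z * y 0 * r 0) * (Y * R) := by rw [c2.symm.eq]; simp only [mul_assoc]
      _ = r 0 * y 0 * (z * Y * R) := by rw [h]; simp only [mul_assoc]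
      _ = r 0 * (y 0 * R) * (Y * z) := by rw [ih']; simp only [mul_assoc]
      _ = _ := by rw [c1.eq]; simp only [mul_assoc]

theorem prod_ofFn_mul_prod_ofFn {a : ℕ} (f g : Fin a → M)
    (h : ∀ k l, k ≠ l → Commute (g k) (f l)) :
    (List.ofFn f).prod * (List.ofFn g).prod = (List.ofFn fun k => f k * g k).prod := by
  induction a with
  | zero => simp
  | succ a ih =>
    have ih' := ih (fun k => f k.succ) (fun k => g k.succ)
      (fun k l hkl => h _ _ (by simpa using hkl))
    have c : Commute (g 0) (List.ofFn fun k => f k.succ).prod :=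
      commute_prod_ofFn fun k => h _ _ (Fin.succ_ne_zero _).symm
    rw [prod_ofFn_succ, prod_ofFn_succ g, prod_ofFn_succ fun k => f k * g k, ← ih', mul_assoc,
      ← mul_assoc _ (g 0), c.symm.eq]
    simp only [mul_assoc]

/-- Exchanging the two loops keeps the relative order of any two factors that share an index; the
remaining pairs commute. -/
theorem prod_ofFn_comm {a b : ℕ} (g : Fin b → Fin a → M)
    (h : ∀ j j' k k', j ≠ j' → k ≠ k' → Commute (g j k) (g j' k')) :
    (List.ofFn fun j => (List.ofFn fun k => g j k).prod).prod =
      (List.ofFn fun k => (List.ofFn fun j => g j k).prod).prod := by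
  induction b with
  | zero => simp [List.ofFn_const]
  | succ b ih =>
    simp only [prod_ofFn_succ (n := b)]
    rw [ih (fun j => g j.succ) fun j j' k k' hj hk => h _ _ _ _ (by simpa using hj) hk,
      prod_ofFn_mul_prod_ofFn]
    exact fun k l hkl => (commute_prod_ofFn fun j => h _ _ _ _ (Fin.succ_ne_zero _).symm hkl.symm).symm

end Products

/-! ### Parity of matrices, cyclicity of the super-trace, and reordering by `R`-matrices -/

section Trace

variable {N n : ℕ} (p : Fin N → ZMod 2)

/-- The matrix `X` is homogeneous of parity `d`. -/
def HasParity {R : Type*} [Zero R] (d : ZMod 2) (X : Matrix (Fin n → Fin N) (Fin n → Fin N) R) :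
    Prop := ∀ I J, X I J ≠ 0 → par p I + par p J = d

variable {p}

theorem HasParity.mul {R : Type*} [Ring R] {d e : ZMod 2}
    {X Y : Matrix (Fin n → Fin N) (Fin n → Fin N) R} (hX : HasParity p d X) (hY : HasParity p e Y) :
    HasParity p (d + e) (X * Y) := by
  intro I J h
  obtain ⟨K, -, hK⟩ := Finset.exists_ne_zero_of_sum_ne_zero (Matrix.mul_apply (M := X) (N := Y) ▸ h)
  rw [← hX I K (left_ne_zero_of_mul hK), ← hY K J (right_ne_zero_of_mul hK)]
  linear_combination -add_self (par p K)

theorem HasParity.add {R : Type*} [Ring R] {d : ZMod 2}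
    {X Y : Matrix (Fin n → Fin N) (Fin n → Fin N) R} (hX : HasParity p d X) (hY : HasParity p d Y) :
    HasParity p d (X + Y) := by
  intro I J h
  by_cases h0 : X I J = 0
  · exact hY I J fun h1 => h (by simp [h0, h1])
  · exact hX I J h0

theorem HasParity.smul {R S : Type*} [Ring R] [SMulZeroClass S R] {d : ZMod 2} (s : S)
    {X : Matrix (Fin n → Fin N) (Fin n → Fin N) R} (hX : HasParity p d X) :
    HasParity p d (s • X) := fun I J h => hX I J fun h0 => h (by simp [h0])

theorem HasParity.sum {R ι : Type*} [Ring R] {d : ZMod 2} (s : Finset ι)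
    {X : ι → Matrix (Fin n → Fin N) (Fin n → Fin N) R} (hX : ∀ i ∈ s, HasParity p d (X i)) :
    HasParity p d (∑ i ∈ s, X i) := by
  intro I J h
  rw [Matrix.sum_apply] at h
  obtain ⟨i, hi, h⟩ := Finset.exists_ne_zero_of_sum_ne_zero h
  exact hX i hi I J h

theorem hasParity_one {R : Type*} [Ring R] :
    HasParity p 0 (1 : Matrix (Fin n → Fin N) (Fin n → Fin N) R) := by
  intro I J h
  obtain rfl : I = J := by
    by_contra h'
    exact h (Matrix.one_apply_ne h')
  exact add_self _

theorem HasParity.prod_ofFn {R : Type*} [Ring R] {a : ℕ} {d : ZMod 2}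
    {X : Fin a → Matrix (Fin n → Fin N) (Fin n → Fin N) R} (hX : ∀ k, HasParity p d (X k)) :
    HasParity p (a * d) (List.ofFn X).prod := by
  induction a with
  | zero => simpa using hasParity_one
  | succ a ih =>
    rw [prod_ofFn_succ]
    convert (hX 0).mul (ih fun k => hX k.succ) using 1
    push_cast; ring

variable (p)

theorem hasParity_elem {R : Type*} [Ring R] (q : Fin n) (i j : Fin N) :
    HasParity p (p i + p j) (elem p R q i j) := by
  intro I J h
  obtain ⟨h1, h2⟩ : J q = j ∧ I = Function.update J q i := by
    by_contra h'
    exact h (by simp [elem, h'])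
  subst h2
  rw [par_update, h1]
  linear_combination add_self (par p J)

theorem hasParity_perm {R : Type*} [Ring R] (q r : Fin n) : HasParity p 0 (perm p R q r) := by
  refine HasParity.sum _ fun i _ => HasParity.sum _ fun j _ => HasParity.smul _ ?_
  convert (hasParity_elem p (R := R) q i j).mul (hasParity_elem p r j i) using 1
  linear_combination -add_self (p i) - add_self (p j)

theorem hasParity_rMat {K : Type*} [Field K] (c : K) (q r : Fin n) (x y : K) :
    HasParity p 0 (rMat p c q r x y) :=
  hasParity_one.add ((hasParity_perm p q r).smul _)

theorem hasParity_rProd {K : Type*} [Field K] (c : K) {a b : ℕ} (u : Fin a → K) (v : Fin b → K) :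
    HasParity p 0 (rProd p c u v) := by
  have := HasParity.prod_ofFn fun j : Fin b => HasParity.prod_ofFn fun k : Fin a =>
    hasParity_rMat p c (Fin.natAdd a j) (Fin.castAdd b k.rev) (v j) (u k.rev)
  simpa [rProd] using this

variable {B : Type*} [Ring B] (γ : B →+* B) {K : Type*} [Field K] [Algebra K B]

/-- An even matrix only connects `I` and `J` of equal parity, so the signs and twists at the two
diagonal positions agree, and its scalar entries commute with `B`. -/
theorem superTrace_mul_comm
    {R : Matrix (Fin n → Fin N) (Fin n → Fin N) K} (hR : HasParity p 0 R)
    (X : Matrix (Fin n → Fin N) (Fin n → Fin N) B) :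
    superTrace p γ (R.map (algebraMap K B) * X) = superTrace p γ (X * R.map (algebraMap K B)) := by
  simp only [superTrace, Matrix.mul_apply, twist_sum, Finset.smul_sum]
  rw [Finset.sum_comm]
  refine Finset.sum_congr rfl fun J _ => Finset.sum_congr rfl fun I _ => ?_
  by_cases h0 : R I J = 0
  · simp [h0, twist]
  · have : par p I = par p J := by linear_combination hR I J h0 - add_self (par p J)
    rw [this, Matrix.map_apply, Algebra.commutes]

theorem map_elem (q : Fin n) (i j : Fin N) :
    (elem p K q i j).map (algebraMap K B) = elem p B q i j := by
  ext I J
  simp only [elem, Matrix.map_apply, Matrix.of_apply]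
  split_ifs <;> simp

theorem map_perm (q r : Fin n) :
    (perm p K q r).map (algebraMap K B) = perm p B q r := by
  have : ∀ X : Matrix (Fin n → Fin N) (Fin n → Fin N) K, X.map (algebraMap K B) =
    (algebraMap K B).mapMatrix X := fun _ => rfl
  simp only [perm, this, map_sum, map_zsmul, map_mul]
  simp only [← this, map_elem]

theorem map_rMat (c : K) (q r : Fin n) (x y : K) :
    (rMat p c q r x y).map (algebraMap K B) = 1 + (c / (x - y)) • perm p B q r := by
  rw [rMat, ← map_perm (K := K) (B := B)]
  ext I J
  rw [Matrix.map_apply, Matrix.add_apply, Matrix.add_apply, Matrix.smul_apply, Matrix.smul_apply,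
    Matrix.map_apply, smul_eq_mul, map_add, map_mul, Algebra.smul_def, Matrix.one_apply,
    Matrix.one_apply]
  split_ifs <;> simp

theorem map_prod_ofFn {a : ℕ} (X : Fin a → Matrix (Fin n → Fin N) (Fin n → Fin N) K) :
    (List.ofFn X).prod.map (algebraMap K B) =
      (List.ofFn fun k => (X k).map (algebraMap K B)).prod := by
  change (algebraMap K B).mapMatrix _ = _
  rw [map_list_prod, List.map_ofFn]
  rfl

/-- The `R`-matrices reverse the order of the two groups of monodromy matrices. -/
theorem tMat_prod_mul_rProd (hγ : ∀ k : K, γ (algebraMap K B k) = algebraMap K B k)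
    {a b : ℕ} (c : K) (u : Fin a → K) (v : Fin b → K) (T : K → Fin N → Fin N → B)
    (hu : ∀ k, IsGraded p γ (T (u k))) (hv : ∀ j, IsGraded p γ (T (v j)))
    (huv : ∀ k j, ExchangeRel p (c / (u k - v j)) (T (u k)) (T (v j))) :
    (List.ofFn fun k : Fin a => tMat p γ (Fin.castAdd b k) (T (u k))).prod *
      (List.ofFn fun j : Fin b => tMat p γ (Fin.natAdd a j) (T (v j))).prod *
      (rProd p c u v).map (algebraMap K B) =
    (rProd p c u v).map (algebraMap K B) *
      ((List.ofFn fun j : Fin b => tMat p γ (Fin.natAdd a j) (T (v j))).prod *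
      (List.ofFn fun k : Fin a => tMat p γ (Fin.castAdd b k) (T (u k))).prod) := by
  have hne : ∀ (k : Fin a) (j : Fin b), Fin.natAdd a j ≠ Fin.castAdd b k := by
    intro k j h
    have := congrArg Fin.val h
    simp at this
    omega
  simp only [rProd, map_prod_ofFn, map_rMat]
  apply mul_prod_mul_prod
  · intro j
    apply prod_mul_mul_prod_rev _ fun k => 1 + (c / (v j - u k)) • perm p B (Fin.natAdd a j)
      (Fin.castAdd b k)
    · intro k
      refine rtt p γ (hne k j) hγ (hv j) (hu k) ?_
      -- Here `-g(v_j, u_k) = g(u_k, v_j)`.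
      rw [← div_neg, neg_sub]
      exact huv k j
    · intro k l hkl
      refine (Commute.one_left _).add_left (Commute.smul_left ?_ _)
      exact perm_commute_tMat p γ (hne l j).symm (by simpa using hkl.symm) (hu l)
  · intro j l hjl
    refine (commute_prod_ofFn fun k => ?_).symm
    refine (Commute.one_right _).add_right (Commute.smul_right ?_ _)
    exact (perm_commute_tMat p γ (by simpa using hjl.symm) (hne _ l) (hv l)).symm

end Trace

/-! ### The graded flip of the two groups of auxiliary spaces -/

section Relabel

variable {N a b : ℕ} (p : Fin N → ZMod 2)

theorem sum_lt_castAdd {M : Type*} [AddCommMonoid M] (f : Fin (a + b) → M) (k : Fin a) :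
    ∑ r with r < Fin.castAdd b k, f r = ∑ r with r < k, f (Fin.castAdd b r) := by
  have h1 (r : Fin a) : Fin.castAdd b r < Fin.castAdd b k ↔ r < k := Iff.rfl
  have h2 (r : Fin b) : ¬ Fin.natAdd a r < Fin.castAdd b k := by
    rw [Fin.lt_def, Fin.val_natAdd, Fin.val_castAdd]
    omega
  rw [Finset.sum_filter, Fin.sum_univ_add, Finset.sum_filter]
  simp only [h1, h2, if_false, Finset.sum_const_zero, add_zero]

theorem sum_lt_natAdd {M : Type*} [AddCommMonoid M] (f : Fin (a + b) → M) (j : Fin b) :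
    ∑ r with r < Fin.natAdd a j, f r =
      ∑ k, f (Fin.castAdd b k) + ∑ r with r < j, f (Fin.natAdd a r) := by
  have h1 (r : Fin a) : Fin.castAdd b r < Fin.natAdd a j := by
    rw [Fin.lt_def, Fin.val_natAdd, Fin.val_castAdd]
    omega
  have h2 (r : Fin b) : Fin.natAdd a r < Fin.natAdd a j ↔ r < j := by
    rw [Fin.lt_def, Fin.lt_def, Fin.val_natAdd, Fin.val_natAdd]
    omega
  rw [Finset.sum_filter, Fin.sum_univ_add, Finset.sum_filter]
  simp only [h1, h2, if_true]

/-- The parity of the exchange of the first `b` factors of `e_I` with the last `a` ones. -/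
def flipSign (I : Fin (b + a) → Fin N) : ZMod 2 :=
  (∑ j, p (I (Fin.castAdd a j))) * ∑ k, p (I (Fin.natAdd b k))

/-- Reordering the first `a` and the last `b` auxiliary spaces. -/
def relabel (R : Type*) [Ring R] : Matrix (Fin (a + b) → Fin N) (Fin (a + b) → Fin N) R →+*
    Matrix (Fin (b + a) → Fin N) (Fin (b + a) → Fin N) R where
  toFun X := Matrix.of fun I J =>
    sgn (flipSign p I + flipSign p J) • X (I ∘ finAddFlip) (J ∘ finAddFlip)
  map_one' := by
    ext I J
    by_cases h : I = J
    · subst h; simp [add_self, sgn_zero]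
    · have : I ∘ finAddFlip ≠ J ∘ (finAddFlip : Fin (a + b) ≃ _) := fun h' =>
        h (finAddFlip.surjective.injective_comp_right h')
      simp [h, this]
  map_zero' := by ext; simp
  map_add' X Y := by ext; simp
  map_mul' X Y := by
    ext I J
    simp only [Matrix.of_apply, Matrix.mul_apply, Finset.smul_sum]
    refine (Fintype.sum_equiv (Equiv.arrowCongr finAddFlip.symm (Equiv.refl (Fin N))) _ _
      fun K => ?_).symm
    rw [smul_mul_smul_comm, ← sgn_add]
    congr 2
    -- The sign is a coboundary: the intermediate index contributes `flipSign p K` twice.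
    linear_combination add_self (flipSign p K)

theorem relabel_apply {R : Type*} [Ring R]
    (X : Matrix (Fin (a + b) → Fin N) (Fin (a + b) → Fin N) R) (I J : Fin (b + a) → Fin N) :
    relabel p R X I J =
      sgn (flipSign p I + flipSign p J) • X (I ∘ finAddFlip) (J ∘ finAddFlip) := rfl

theorem par_comp_flip (I : Fin (b + a) → Fin N) :
    par p (I ∘ (finAddFlip : Fin (a + b) ≃ _)) = par p I :=
  Equiv.sum_comp finAddFlip fun q => p (I q)

theorem flipSign_update_castAdd (J : Fin (b + a) → Fin N) (j : Fin b) (i : Fin N) :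
    flipSign p (Function.update J (Fin.castAdd a j) i) = flipSign p J +
      (p (J (Fin.castAdd a j)) + p i) * ∑ k, p (J (Fin.natAdd b k)) := by
  have h1 (k : Fin a) : Fin.natAdd b k ≠ Fin.castAdd a j := fun h => by
    have := congrArg Fin.val h
    simp at this
    omega
  have h2 (j' : Fin b) : Function.update J (Fin.castAdd a j) i (Fin.castAdd a j') =
      Function.update (fun r => J (Fin.castAdd a r)) j i j' := by
    by_cases h : j' = j
    · subst h; simp
    · simp [h]
  simp only [flipSign, h2, Function.update_of_ne (h1 _), sum_update p _ (Finset.mem_univ j)]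
  ring

theorem flipSign_update_natAdd (J : Fin (b + a) → Fin N) (k : Fin a) (i : Fin N) :
    flipSign p (Function.update J (Fin.natAdd b k) i) = flipSign p J +
      (p (J (Fin.natAdd b k)) + p i) * ∑ j, p (J (Fin.castAdd a j)) := by
  have h1 (j : Fin b) : Fin.castAdd a j ≠ Fin.natAdd b k := fun h => by
    have := congrArg Fin.val h
    simp at this
    omega
  have h2 (k' : Fin a) : Function.update J (Fin.natAdd b k) i (Fin.natAdd b k') =
      Function.update (fun r => J (Fin.natAdd b r)) k i k' := by
    by_cases h : k' = k
    · subst h; simp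
    · simp [h]
  simp only [flipSign, h2, Function.update_of_ne (h1 _), sum_update p _ (Finset.mem_univ k)]
  ring

/-- The prefix parities at the old and the new position differ by the total parity of the other
block. Replacing `j` by `i` changes `flipSign` by `[i] + [j]` times this same parity, so the two
effects cancel. -/
theorem relabel_elem {R : Type*} [Ring R] (q : Fin (a + b)) (i j : Fin N) :
    relabel p R (elem p R q i j) = elem p R (finAddFlip q) i j := by
  ext I J
  have h : I ∘ finAddFlip = Function.update (J ∘ finAddFlip) q i ↔
      I = Function.update J (finAddFlip q) i := by
    rw [← Function.update_comp_eq_of_injective J finAddFlip.injective]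
    exact finAddFlip.surjective.injective_comp_right.eq_iff
  rw [relabel_apply, elem_apply, elem_apply]
  simp only [h, Function.comp_apply]
  by_cases hq : J (finAddFlip q) = j
  swap
  · simp [hq]
  by_cases hI : I = Function.update J (finAddFlip q) i
  swap
  · simp [hI]
  simp only [hq, hI, if_true, sgn_smul_sgn_smul]
  congr 2
  clear h hI
  induction q using Fin.addCases with
  | left k =>
    rw [finAddFlip_apply_castAdd] at *
    rw [flipSign_update_natAdd, sum_lt_castAdd, sum_lt_natAdd, hq]
    simp only [finAddFlip_apply_castAdd]
    linear_combination add_self (flipSign p J)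
  | right k =>
    rw [finAddFlip_apply_natAdd] at *
    rw [flipSign_update_castAdd, sum_lt_castAdd, sum_lt_natAdd, hq]
    simp only [finAddFlip_apply_castAdd, finAddFlip_apply_natAdd]
    linear_combination add_self (flipSign p J) +
      (p i + p j) * add_self (∑ k, p (J (Fin.natAdd b k)))

theorem relabel_inB {B : Type*} [Ring B] (γ : B →+* B) (x : B) :
    relabel (a := a) (b := b) p B (inB p γ x) = inB p γ x := by
  ext I J
  rw [relabel_apply]
  by_cases h : I = J
  · subst h
    simp [inB, par_comp_flip, add_self, sgn_zero]
  · have : I ∘ finAddFlip ≠ J ∘ (finAddFlip : Fin (a + b) ≃ _) := fun h' =>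
      h (finAddFlip.surjective.injective_comp_right h')
    simp [inB, h, this]

theorem relabel_tMat {B : Type*} [Ring B] (γ : B →+* B) (q : Fin (a + b))
    (T : Fin N → Fin N → B) :
    relabel p B (tMat p γ q T) = tMat p γ (finAddFlip q) T := by
  simp only [tMat, map_sum, map_mul, relabel_elem, relabel_inB]

theorem relabel_perm {R : Type*} [Ring R] (q r : Fin (a + b)) :
    relabel p R (perm p R q r) = perm p R (finAddFlip q) (finAddFlip r) := by
  simp only [perm, map_sum, map_zsmul, map_mul, relabel_elem]

theorem relabel_rMat {K : Type*} [Field K] (c : K) (q r : Fin (a + b)) (x y : K) :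
    relabel p K (rMat p c q r x y) = rMat p c (finAddFlip q) (finAddFlip r) x y := by
  have (g : K) (X : Matrix (Fin (a + b) → Fin N) (Fin (a + b) → Fin N) K) :
      relabel p K (g • X) = g • relabel p K X := by
    ext I J
    simp only [relabel_apply, Matrix.smul_apply]
    exact smul_comm _ _ _
  rw [rMat, map_add, map_one, this, relabel_perm, rMat]

theorem relabel_prod_ofFn {R : Type*} [Ring R] {m : ℕ}
    (X : Fin m → Matrix (Fin (a + b) → Fin N) (Fin (a + b) → Fin N) R) :
    relabel p R (List.ofFn X).prod = (List.ofFn fun k => relabel p R (X k)).prod := by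
  rw [map_list_prod, List.map_ofFn]
  rfl

theorem relabel_map {K B : Type*} [Field K] [Ring B] (f : K →+* B)
    (X : Matrix (Fin (a + b) → Fin N) (Fin (a + b) → Fin N) K) :
    relabel p B (X.map f) = (relabel p K X).map f := by
  ext I J
  simp [relabel_apply]

theorem superTrace_relabel {B : Type*} [Ring B] (γ : B →+* B)
    (X : Matrix (Fin (a + b) → Fin N) (Fin (a + b) → Fin N) B) :
    superTrace p γ (relabel p B X) = superTrace p γ X := by
  refine Fintype.sum_equiv (Equiv.arrowCongr finAddFlip.symm (Equiv.refl (Fin N))) _ _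
      fun K => ?_
  have : (Equiv.arrowCongr finAddFlip.symm (Equiv.refl (Fin N))) K =
    K ∘ (finAddFlip : Fin (a + b) ≃ _) := rfl
  rw [this, par_comp_flip, relabel_apply, add_self, sgn_zero, one_smul]

end Relabel

theorem mul_self_parity (x : ZMod 2) : x * x = x := by revert x; decide

/-! ### Super-transposition with reversal of the basis -/

section Transpose

variable {N n : ℕ} (p : Fin N → ZMod 2)

/-- The sign in the super-transposition of the matrix entry `(J, I)`. -/
def transposeSign (I J : Fin n → Fin N) : ZMod 2 :=
  ∑ q, ((p (I q) + p (J q)) * (∑ r with q < r, (p (I r) + p (J r)) + (1 + (q : ℕ))) +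
    p (J q) * (p (I q) + 1))

theorem sum_mul_sum_gt {R : Type*} [CommRing R] (x y : Fin n → R) :
    ∑ q, (x q * ∑ r with q < r, y r + y q * ∑ r with q < r, x r) =
      (∑ q, x q) * (∑ q, y q) - ∑ q, x q * y q := by
  have h (q : Fin n) : x q * ∑ r, y r = x q * ∑ r with q < r, y r +
      (∑ r with r < q, x q * y r) + x q * y q := by
    have : ∑ r, y r = ∑ r with q < r, y r + ∑ r with r < q, y r + y q := by
      rw [← Finset.sum_filter_add_sum_filter_not Finset.univ (fun r => q < r), add_assoc]
      congr 1
      have : Finset.univ.filter (fun r => ¬ q < r) = insert q (Finset.univ.filter fun r => r < q) := by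
        ext r; simp [le_iff_eq_or_lt]
      rw [this, Finset.sum_insert (by simp), add_comm]
    rw [this, mul_add, mul_add, Finset.mul_sum _ _ (x q), Finset.mul_sum _ _ (x q)]
  rw [Finset.sum_mul]
  simp only [h, Finset.sum_add_distrib, add_sub_cancel_right]
  congr 1
  simp only [Finset.mul_sum, Finset.sum_filter]
  rw [Finset.sum_comm]
  refine Finset.sum_congr rfl fun i _ => Finset.sum_congr rfl fun j _ => ?_
  split_ifs <;> ring

/-- The terms with `q < r` would be additive but for the mixed products, which `sum_mul_sum_gt`
gathers into the product of the two total parities minus a diagonal part. The diagonal part is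
absorbed by `p (J q) * (p (I q) + 1)`, and the remaining defect is the Koszul sign of `superT_mul`.
-/
theorem transposeSign_add (I J K : Fin n → Fin N) :
    transposeSign p I K + transposeSign p K J =
      transposeSign p I J + (par p I + par p K) * (par p K + par p J) := by
  have h := sum_mul_sum_gt (fun q => p (I q) + p (K q)) (fun q => p (K q) + p (J q))
  simp only [par, ← Finset.sum_add_distrib]
  rw [sub_eq_iff_eq_add.1 h.symm]
  simp only [transposeSign]
  simp only [← Finset.sum_add_distrib]
  refine Finset.sum_congr rfl fun q _ => ?_
  simp only [Finset.sum_add_distrib]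
  generalize ∑ r with q < r, p (I r) = x1; generalize ∑ r with q < r, p (J r) = y1
  generalize ∑ r with q < r, p (K r) = z1; generalize p (I q) = x; generalize p (J q) = y
  generalize p (K q) = z; generalize ((q : ℕ) : ZMod 2) = w
  clear * -
  revert x y z x1 y1 z1 w; decide

/-- The super-transposition of scalar matrices, composed with the reversal of the basis. -/
def superT (K : Type*) [Field K] : Matrix (Fin n → Fin N) (Fin n → Fin N) K →ₗ[K]
    Matrix (Fin n → Fin N) (Fin n → Fin N) K where
  toFun X := Matrix.of fun I J =>
    sgn (transposeSign p (Fin.rev ∘ I) (Fin.rev ∘ J)) • X (Fin.rev ∘ J) (Fin.rev ∘ I)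
  map_add' X Y := by ext; simp
  map_smul' g X := by ext; simp [mul_left_comm]

variable {K : Type*} [Field K]

theorem superT_apply (X : Matrix (Fin n → Fin N) (Fin n → Fin N) K) (I J : Fin n → Fin N) :
    superT p K X I J =
      sgn (transposeSign p (Fin.rev ∘ I) (Fin.rev ∘ J)) • X (Fin.rev ∘ J) (Fin.rev ∘ I) := rfl

theorem superT_one : superT p K (1 : Matrix (Fin n → Fin N) (Fin n → Fin N) K) = 1 := by
  ext I J
  rw [superT_apply]
  by_cases h : I = J
  · subst h
    have : transposeSign p (Fin.rev ∘ I) (Fin.rev ∘ I) = 0 := by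
      refine Finset.sum_eq_zero fun q _ => ?_
      rw [add_self, zero_mul, mul_add, mul_self_parity, mul_one, add_self, zero_add]
    simp [this, sgn_zero]
  · have : Fin.rev ∘ J ≠ Fin.rev ∘ I := fun h' =>
      h (Fin.rev_injective.comp_left h').symm
    simp [h, this]

variable {p}

theorem superT_mul {d e : ZMod 2} {X Y : Matrix (Fin n → Fin N) (Fin n → Fin N) K}
    (hX : HasParity p d X) (hY : HasParity p e Y) :
    superT p K (X * Y) = sgn (d * e) • (superT p K Y * superT p K X) := by
  ext I J
  rw [superT_apply, Matrix.smul_apply, Matrix.mul_apply, Matrix.mul_apply, Finset.smul_sum,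
    Finset.smul_sum]
  -- The intermediate index has to be reversed along with the outer ones.
  refine (Fintype.sum_equiv (Equiv.arrowCongr (Equiv.refl (Fin n)) Fin.revPerm) _ _
      fun L => ?_).symm
  have : (Equiv.arrowCongr (Equiv.refl (Fin n)) Fin.revPerm) L = Fin.rev ∘ L := rfl
  rw [this, superT_apply, superT_apply, smul_mul_smul_comm, ← sgn_add, transposeSign_add,
    sgn_smul_sgn_smul, mul_comm (Y _ _)]
  by_cases h0 : X (Fin.rev ∘ J) (Fin.rev ∘ L) = 0
  · simp [h0]
  by_cases h1 : Y (Fin.rev ∘ L) (Fin.rev ∘ I) = 0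
  · simp [h1]
  rw [← hX _ _ h0, ← hY _ _ h1]
  congr 2
  generalize par p (Fin.rev ∘ I) = x; generalize par p (Fin.rev ∘ J) = y
  generalize par p (Fin.rev ∘ L) = z; generalize transposeSign p (Fin.rev ∘ I) (Fin.rev ∘ J) = w
  revert x y z w; decide

theorem superT_prod_ofFn {a : ℕ} {X : Fin a → Matrix (Fin n → Fin N) (Fin n → Fin N) K}
    (hX : ∀ k, HasParity p 0 (X k)) :
    superT p K (List.ofFn X).prod = (List.ofFn fun k => superT p K (X k.rev)).prod := by
  induction a with
  | zero => simpa using superT_one p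
  | succ a ih =>
    rw [prod_ofFn_succ, prod_ofFn_rev_succ fun k => superT p K (X k),
      superT_mul (hX 0) (HasParity.prod_ofFn fun k => hX k.succ), ih fun k => hX k.succ,
      zero_mul, sgn_zero, one_smul]

/-- Transposition reverses the product at the cost of a sign; restoring the original order of
factors that commute up to `sgn d` costs the same sign again, since `d * d = d`. -/
theorem superT_prod_ofFn_of_comm {a : ℕ} {d : ZMod 2}
    {X : Fin a → Matrix (Fin n → Fin N) (Fin n → Fin N) K} (hX : ∀ k, HasParity p d (X k))
    (hc : ∀ k l, k ≠ l → superT p K (X k) * superT p K (X l) =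
      sgn d • (superT p K (X l) * superT p K (X k))) :
    superT p K (List.ofFn X).prod = (List.ofFn fun k => superT p K (X k)).prod := by
  induction a with
  | zero => simpa using superT_one p
  | succ a ih =>
    rw [prod_ofFn_succ, prod_ofFn_succ fun k => superT p K (X k),
      superT_mul (hX 0) (HasParity.prod_ofFn fun k => hX k.succ),
      ih (fun k => hX k.succ) fun k l hkl => hc _ _ (by simpa using hkl)]
    have h : ∀ {m : ℕ} (y : Matrix (Fin n → Fin N) (Fin n → Fin N) K)
        (Z : Fin m → Matrix (Fin n → Fin N) (Fin n → Fin N) K)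
        (_ : ∀ k, Z k * y = sgn d • (y * Z k)),
        (List.ofFn Z).prod * y = sgn (m * d) • (y * (List.ofFn Z).prod) := by
      intro m y Z hZ
      induction m with
      | zero => simp [sgn_zero]
      | succ m ihm =>
        rw [prod_ofFn_succ, mul_assoc, ihm (fun k => Z k.succ) fun k => hZ _, mul_smul_comm,
          ← mul_assoc, hZ, smul_mul_assoc, sgn_smul_sgn_smul, mul_assoc]
        congr 2
        push_cast; ring
    rw [h _ _ fun k => hc _ _ (Fin.succ_ne_zero k), sgn_smul_sgn_smul]
    have : d * (a * d) + a * d = 0 := by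
      linear_combination a * mul_self_parity d + add_self (a * d)
    rw [this, sgn_zero, one_smul]

variable {p' : Fin N → ZMod 2}

/-- The shift of the gradation adds one unit for each of the `q` positions before `q` to the prefix
parity. The term `1 + q` in `transposeSign` is there to compensate for this, leaving a sign
independent of the position. -/
theorem superT_elem (hp : ∀ j, p' j = p j.rev + 1) (q : Fin n) (i j : Fin N) :
    superT p K (elem p K q i j) = sgn (p i * p j + p j) • elem p' K q j.rev i.rev := by
  ext I J
  rw [superT_apply, Matrix.smul_apply]
  simp only [elem, Matrix.of_apply]
  by_cases h : I q = j.rev ∧ J = Function.update I q i.rev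
  · have h1 : (Fin.rev ∘ I) q = j ∧ Fin.rev ∘ J = Function.update (Fin.rev ∘ I) q i := by
      rw [h.2, Function.comp_update, Fin.rev_rev]
      simp [h.1]
    have h2 : J q = i.rev ∧ I = Function.update J q j.rev := by
      simp [h.2, ← h.1]
    have h3 : transposeSign p (Fin.rev ∘ I) (Fin.rev ∘ J) =
        (p i + p j) * (1 + (q : ℕ)) + p i * (p j + 1) := by
      rw [h1.2, transposeSign, Finset.sum_eq_single q]
      · rw [Function.update_self, h1.1, Finset.sum_eq_zero]
        · ring
        · intro r hr
          rw [Function.update_of_ne (Finset.mem_filter.1 hr).2.ne', add_self]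
      · intro r _ hr
        rw [Function.update_of_ne hr, add_self, zero_mul, mul_add, mul_self_parity, mul_one,
          add_self, zero_add]
      · simp
    have h4 : ∑ r with r < q, p' (J r) = ∑ r with r < q, p ((Fin.rev ∘ I) r) + (q : ℕ) := by
      have : (Finset.univ.filter fun r : Fin n => r < q).card = q := by
        rw [← Fin.card_Iio q]
        congr 1
        ext r
        simp only [Finset.mem_filter, Finset.mem_univ, true_and, Finset.mem_Iio]
      simp only [hp, Finset.sum_add_distrib, Finset.sum_const, this, nsmul_eq_mul, mul_one]
      congr 1
      refine Finset.sum_congr rfl fun r hr => ?_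
      rw [h.2, Function.update_of_ne (Finset.mem_filter.1 hr).2.ne]
      rfl
    rw [if_pos h1, if_pos h2, h3, h4, hp, hp, Fin.rev_rev, Fin.rev_rev, zsmul_eq_mul, zsmul_eq_mul,
      ← Int.cast_mul, ← Int.cast_mul, ← sgn_add, ← sgn_add]
    congr 2
    generalize p i = x; generalize p j = y; generalize ((q : ℕ) : ZMod 2) = z
    generalize ∑ r with r < q, p ((Fin.rev ∘ I) r) = w
    clear * -
    revert x y z w; decide
  · have h1 : ¬ ((Fin.rev ∘ I) q = j ∧ Fin.rev ∘ J = Function.update (Fin.rev ∘ I) q i) := by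
      rintro ⟨h1, h2⟩
      refine h ⟨by rw [← h1]; simp, ?_⟩
      apply Fin.rev_injective.comp_left
      change Fin.rev ∘ J = Fin.rev ∘ _
      rw [h2, Function.comp_update, Fin.rev_rev]
    have h2 : ¬ (J q = i.rev ∧ I = Function.update J q j.rev) := by
      rintro ⟨h3, h2⟩
      subst h2
      exact h ⟨by simp, by simp [← h3]⟩
    rw [if_neg h1, if_neg h2, smul_zero, smul_zero]

/-- The minus sign reflects the parity shift in `p'`: exchanging even and odd vectors turns the
graded permutation into its negative. In `superT_rMat` it is absorbed by `g(x, y) = -g(y, x)`. -/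
theorem superT_perm (hp : ∀ j, p' j = p j.rev + 1) {q r : Fin n} (h : q ≠ r) :
    superT p K (perm p K q r) = -perm p' K q r := by
  have key (i j : Fin N) : superT p K (sgn (p j) • (elem p K q i j * elem p K r j i)) =
      -(sgn (p' i.rev) • (elem p' K q j.rev i.rev * elem p' K r i.rev j.rev)) := by
    rw [map_zsmul, superT_mul (hasParity_elem p q i j) (hasParity_elem p r j i), superT_elem hp,
      superT_elem hp, smul_mul_smul_comm, elem_comm p' h.symm, ← sgn_add, sgn_smul_sgn_smul,
      sgn_smul_sgn_smul, sgn_smul_sgn_smul, hp, hp, Fin.rev_rev, Fin.rev_rev, ← neg_smul]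
    congr 1
    generalize p i = x; generalize p j = y
    clear * -
    revert x y; decide
  simp only [perm, map_sum, key]
  rw [Finset.sum_comm (f := fun i j => sgn (p' j) • (elem p' K q i j * elem p' K r j i))]
  simp only [Finset.sum_neg_distrib]
  rw [neg_inj]
  exact Fintype.sum_equiv Fin.revPerm _ _ fun i => Fintype.sum_equiv Fin.revPerm _ _ fun j => rfl

theorem superT_rMat (hp : ∀ j, p' j = p j.rev + 1) {q r : Fin n} (h : q ≠ r) (c x y : K) :
    superT p K (rMat p c q r x y) = rMat p' c r q y x := by
  rw [rMat, map_add, superT_one, map_smul, superT_perm hp h, rMat, perm_symm p' h, smul_neg,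
    ← neg_smul, ← div_neg, neg_sub]

end Transpose

/-! ### Entries of products of monodromy matrices and their image under the isomorphism -/

section MonodromyProduct

variable {N n : ℕ} (p : Fin N → ZMod 2) {B : Type*} [Ring B] (γ : B →+* B)

theorem map_prod_ofFn_of_sgn {B' : Type*} [Ring B'] (f : B →+* B') {m : ℕ} {d : Fin m → ZMod 2}
    {x : Fin m → B} {y : Fin m → B'} (h : ∀ k, f (x k) = sgn (d k) • y k) :
    f (List.ofFn x).prod = sgn (∑ k, d k) • (List.ofFn y).prod := by
  induction m with
  | zero => simp [sgn_zero]
  | succ m ih =>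
    rw [prod_ofFn_succ, prod_ofFn_succ y, map_mul, h, ih fun k => h k.succ, smul_mul_smul_comm,
      Fin.sum_univ_succ, sgn_add]

/-- The elementary matrix contributes the parity of the positions before `s`, and the twist of the
entry the parity of all positions; modulo 2 only the positions from `s` onwards remain. -/
theorem mul_tMat_apply {T : Fin N → Fin N → B} (hT : IsGraded p γ T) (s : Fin n)
    (M : Matrix (Fin n → Fin N) (Fin n → Fin N) B) (I J : Fin n → Fin N) :
    (M * tMat p γ s T) I J = ∑ k, sgn ((p k + p (J s)) * ∑ r with s ≤ r, p (J r)) •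
      (M I (Function.update J s k) * T k (J s)) := by
  have h1 : par p J = ∑ r with r < s, p (J r) + ∑ r with s ≤ r, p (J r) := by
    rw [par, ← Finset.sum_filter_add_sum_filter_not Finset.univ (fun r => r < s)]
    simp only [not_lt]
  generalize ∑ r with s ≤ r, p (J r) = S at *
  have h2 (i j : Fin N) : (M * (elem p B s i j * inB p γ (T i j)) : Matrix _ _ B) I J =
      if J s = j then sgn ((p i + p (J s)) * S) •
        (M I (Function.update J s i) * T i (J s)) else 0 := by
    rw [← mul_assoc, inB, Matrix.mul_diagonal, mul_elem_apply]
    split_ifs with h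
    · rw [h, twist_of_homogeneous γ (hT i j), smul_mul_smul_comm, ← sgn_add, h1]
      congr 2
      linear_combination (p i + p j) * add_self (∑ r with r < s, p (J r))
    · rw [zero_mul]
  simp only [tMat, Finset.mul_sum, Matrix.sum_apply, h2, Finset.sum_ite_eq, Finset.mem_univ,
    if_true]

/-- The sign in the entries of `T_1 ⋯ T_n`. -/
def monodromySign (I J : Fin n → Fin N) : ZMod 2 :=
  ∑ q, (p (I q) + p (J q)) * (p (J q) + ∑ r with q < r, p (I r))

/-- Fixing `n` and multiplying only the first `m` factors makes induction possible inside one matrix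
algebra: the positions from `m` on are untouched, which is the condition in the `if`. -/
theorem tMat_prefix_prod_apply {T : Fin n → Fin N → Fin N → B} (hT : ∀ q, IsGraded p γ (T q))
    (m : ℕ) (hm : m ≤ n) (I J : Fin n → Fin N) :
    (List.ofFn fun k : Fin m => tMat p γ (Fin.castLE hm k) (T (Fin.castLE hm k))).prod I J =
      if ∀ r : Fin n, m ≤ r → I r = J r then
        sgn (∑ k : Fin m, (p (I (Fin.castLE hm k)) + p (J (Fin.castLE hm k))) *
          (p (J (Fin.castLE hm k)) + ∑ r with Fin.castLE hm k < r, p (I r))) •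
        (List.ofFn fun k : Fin m =>
          T (Fin.castLE hm k) (I (Fin.castLE hm k)) (J (Fin.castLE hm k))).prod
      else 0 := by
  induction m generalizing J with
  | zero =>
    by_cases h : I = J
    · subst h; simp [sgn_zero]
    · have : ¬ ∀ r, I r = J r := fun h' => h (funext h')
      simp [h, this]
  | succ m ih =>
    set s : Fin n := Fin.castLE hm (Fin.last m) with hs
    have hsv : (s : ℕ) = m := rfl
    have hlt (k : Fin m) : Fin.castLE hm k.castSucc < s := by
      rw [Fin.lt_def, hsv]; exact k.2
    have ih' := fun J => ih (by omega) J
    rw [List.ofFn_succ', List.prod_concat, ← hs, mul_tMat_apply p γ (hT s)]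
    change ∀ J, (List.ofFn fun k : Fin m => tMat p γ (Fin.castLE hm k.castSucc)
      (T (Fin.castLE hm k.castSucc))).prod I J = _ at ih'
    by_cases h : ∀ r : Fin n, m + 1 ≤ r → I r = J r
    -- Position `s` is not yet touched by the shorter product, so the summation index there is
    -- forced to be `I s`.
    · rw [if_pos h, Finset.sum_eq_single (I s)]
      · have h1 : ∀ r : Fin n, m ≤ r → I r = Function.update J s (I s) r := by
          intro r hr
          by_cases hrs : r = s
          · subst hrs; simp
          · rw [Function.update_of_ne hrs]
            refine h r ?_
            have : (r : ℕ) ≠ m := fun h' => hrs (Fin.ext h')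
            omega
        have h2 : ∑ r with s ≤ r, p (J r) = p (J s) + ∑ r with s < r, p (I r) := by
          have : (Finset.univ.filter fun r => s ≤ r) =
              insert s (Finset.univ.filter fun r => s < r) := by
            ext r; simp [le_iff_eq_or_lt, eq_comm]
          rw [this, Finset.sum_insert (by simp)]
          congr 1
          refine Finset.sum_congr rfl fun r hr => ?_
          rw [h r]
          have := (Finset.mem_filter.1 hr).2
          rw [Fin.lt_def, hsv] at this
          omega
        rw [ih', if_pos h1, smul_mul_assoc, sgn_smul_sgn_smul, Fin.sum_univ_castSucc,
          List.ofFn_succ', List.prod_concat, h2, add_comm]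
        have h3 (k : Fin m) : Function.update J s (I s) (Fin.castLE (by omega) k) =
            J (Fin.castLE hm k.castSucc) := Function.update_of_ne (hlt k).ne _ _
        simp only [h3]
        rfl
      · intro k _ hk
        rw [ih', if_neg, zero_mul, smul_zero]
        intro h'
        apply hk
        have := h' s hsv.ge
        rw [this, Function.update_self]
      · simp
    · rw [if_neg h]
      refine Finset.sum_eq_zero fun k _ => ?_
      rw [ih', if_neg, zero_mul, smul_zero]
      intro h'
      refine h fun r hr => ?_
      have hrs : r ≠ s := fun h0 => by rw [h0, hsv] at hr; omega
      rw [h' r (by omega), Function.update_of_ne hrs]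

theorem tMat_prod_apply {T : Fin n → Fin N → Fin N → B} (hT : ∀ q, IsGraded p γ (T q))
    (I J : Fin n → Fin N) :
    (List.ofFn fun q => tMat p γ q (T q)).prod I J =
      sgn (monodromySign p I J) • (List.ofFn fun q => T q (I q) (J q)).prod := by
  refine (tMat_prefix_prod_apply p γ hT n le_rfl I J).trans (if_pos fun r hr => ?_)
  exact absurd r.2 hr.not_gt

variable {K : Type*} [Field K] [Algebra K B]

/-- The product of the entries has parity `[I] + [J]`, so the sign of the super-trace and its twist
combine to `[I] + [I]([I] + [J]) = [I][J]`. -/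
theorem superTrace_tMat_prod_mul (hγ : ∀ k : K, γ (algebraMap K B k) = algebraMap K B k)
    {T : Fin n → Fin N → Fin N → B} (hT : ∀ q, IsGraded p γ (T q))
    (C : Matrix (Fin n → Fin N) (Fin n → Fin N) K) :
    superTrace p γ ((List.ofFn fun q => tMat p γ q (T q)).prod * C.map (algebraMap K B)) =
      ∑ I, ∑ J, sgn (par p I * par p J + monodromySign p I J) •
        ((List.ofFn fun q => T q (I q) (J q)).prod * algebraMap K B (C J I)) := by
  refine Finset.sum_congr rfl fun I _ => ?_
  rw [Matrix.mul_apply, twist_sum, Finset.smul_sum]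
  refine Finset.sum_congr rfl fun J _ => ?_
  rw [tMat_prod_apply p γ hT, Matrix.map_apply]
  have hg : γ (sgn (monodromySign p I J) • (List.ofFn fun q => T q (I q) (J q)).prod *
      algebraMap K B (C J I)) = sgn (par p I + par p J) •
      (sgn (monodromySign p I J) • (List.ofFn fun q => T q (I q) (J q)).prod *
        algebraMap K B (C J I)) := by
    rw [map_mul, map_zsmul, map_prod_ofFn_of_sgn γ fun q => hT q (I q) (J q), hγ,
      Finset.sum_add_distrib, smul_comm, smul_mul_assoc (sgn (_ + _))]
    rfl
  rw [twist_of_homogeneous γ hg, smul_mul_assoc, sgn_smul_sgn_smul, sgn_smul_sgn_smul]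
  congr 2
  linear_combination mul_self_parity (par p I) + add_self (par p I)

variable {p} {p' : Fin N → ZMod 2}

/-- This matches all the signs at once: those of the trace formula for `p` and of the isomorphism on
one side, those of the trace formula for `p'` and of the transposition on the other. The shift
changes each total parity by `n`, and `hcard` splits `n` as the number of positions after `q` plus
`1 + q`, so that the comparison can be made separately for each `q`. -/
theorem monodromySign_rev (hp : ∀ j, p' j = p j.rev + 1) (I J : Fin n → Fin N) :
    par p I * par p J + monodromySign p I J + ∑ q, (p (I q) * p (J q) + p (J q) + 1) =
      par p' (Fin.rev ∘ J) * par p' (Fin.rev ∘ I) +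
        monodromySign p' (Fin.rev ∘ J) (Fin.rev ∘ I) + transposeSign p I J := by
  have hpar (L : Fin n → Fin N) : par p' (Fin.rev ∘ L) = par p L + n := by
    simp [par, hp, Finset.sum_add_distrib]
  have h1 : par p' (Fin.rev ∘ J) * par p' (Fin.rev ∘ I) =
      par p I * par p J + ∑ q, (n * (p (I q) + p (J q)) + 1) := by
    rw [Finset.sum_add_distrib, ← Finset.mul_sum, Finset.sum_add_distrib, hpar, hpar, par, par]
    simp only [mul_one, Finset.sum_const, Finset.card_univ, Fintype.card_fin, nsmul_eq_mul]
    linear_combination mul_self_parity (n : ZMod 2)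
  have hcard (q : Fin n) : ((Finset.univ.filter fun r => q < r).card : ZMod 2) + (1 + (q : ℕ)) = n := by
    have h : (Finset.univ.filter fun r => q < r) = Finset.Ioi q := by
      ext r
      simp only [Finset.mem_filter, Finset.mem_univ, true_and, Finset.mem_Ioi]
    rw [h, Fin.card_Ioi]
    have := q.2
    norm_cast
    congr 1
    omega
  rw [h1, add_assoc, add_assoc, add_assoc, add_right_inj]
  simp only [monodromySign, transposeSign]
  simp only [← Finset.sum_add_distrib]
  refine Finset.sum_congr rfl fun q _ => ?_
  simp only [Function.comp_apply, hp, Fin.rev_rev, Finset.sum_add_distrib, Finset.sum_const,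
    nsmul_eq_mul, mul_one]
  rw [← hcard q]
  generalize ((Finset.univ.filter fun r => q < r).card : ZMod 2) = c
  generalize ((q : ℕ) : ZMod 2) = w
  generalize ∑ r with q < r, p (I r) = x1; generalize ∑ r with q < r, p (J r) = y1
  generalize p (I q) = x; generalize p (J q) = y
  clear * -
  revert x y x1 y1 c w; decide

/-- Since `φ` keeps the order of the operators and transposes the indices of each, the transposition
falls entirely on the scalar matrix `C`. -/
theorem map_superTrace_tMat_prod_mul (hp : ∀ j, p' j = p j.rev + 1)
    (hγ : ∀ k : K, γ (algebraMap K B k) = algebraMap K B k)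
    {B' : Type*} [Ring B'] [Algebra K B'] (γ' : B' →+* B')
    (hγ' : ∀ k : K, γ' (algebraMap K B' k) = algebraMap K B' k)
    {T : Fin n → Fin N → Fin N → B} (hT : ∀ q, IsGraded p γ (T q))
    {T' : Fin n → Fin N → Fin N → B'} (hT' : ∀ q, IsGraded p' γ' (T' q)) (φ : B →+* B')
    (hφ : ∀ k : K, φ (algebraMap K B k) = algebraMap K B' k)
    (hφT : ∀ q i j, φ (T q i j) = sgn (p i * p j + p j + 1) • T' q j.rev i.rev)
    (C : Matrix (Fin n → Fin N) (Fin n → Fin N) K) :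
    φ (superTrace p γ ((List.ofFn fun q => tMat p γ q (T q)).prod * C.map (algebraMap K B))) =
      superTrace p' γ' ((List.ofFn fun q => tMat p' γ' q (T' q)).prod *
        (superT p K C).map (algebraMap K B')) := by
  rw [superTrace_tMat_prod_mul p γ hγ hT, superTrace_tMat_prod_mul p' γ' hγ' hT', Finset.sum_comm]
  simp only [map_sum]
  refine Fintype.sum_equiv (Equiv.arrowCongr (Equiv.refl (Fin n)) Fin.revPerm) _ _ fun J =>
    Fintype.sum_equiv (Equiv.arrowCongr (Equiv.refl (Fin n)) Fin.revPerm) _ _ fun I => ?_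
  have h (L : Fin n → Fin N) :
    (Equiv.arrowCongr (Equiv.refl (Fin n)) Fin.revPerm) L = Fin.rev ∘ L := rfl
  have h' (L : Fin n → Fin N) : Fin.rev ∘ Fin.rev ∘ L = L := by
    ext q; simp
  rw [h, h, map_zsmul, map_mul, map_prod_ofFn_of_sgn φ fun q => hφT q (I q) (J q), hφ,
    smul_mul_assoc, sgn_smul_sgn_smul, superT_apply, h', h', map_zsmul, mul_smul_comm,
    sgn_smul_sgn_smul, monodromySign_rev hp]
  rfl

end MonodromyProduct

theorem castAdd_ne_natAdd {a b : ℕ} (k : Fin a) (j : Fin b) : Fin.castAdd b k ≠ Fin.natAdd a j := by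
  intro h
  have := congrArg Fin.val h
  rw [Fin.val_castAdd, Fin.val_natAdd] at this
  omega

theorem prod_ofFn_append {M α : Type*} [Monoid M] {a b : ℕ} (u : Fin a → α) (v : Fin b → α)
    (f : Fin (a + b) → α → M) :
    (List.ofFn fun q => f q (Fin.append u v q)).prod =
      (List.ofFn fun k => f (Fin.castAdd b k) (u k)).prod *
        (List.ofFn fun j => f (Fin.natAdd a j) (v j)).prod := by
  have h (k : Fin a) : Fin.append u v (Fin.castLE (Nat.le_add_right a b) k) = u k :=
    Fin.append_left u v k
  rw [List.ofFn_add, List.prod_append]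
  simp only [h, Fin.append_right]
  rfl

/-! ### The symmetry of the trace defining the Bethe vectors -/

section Trace

variable {p p' : Fin 3 → ZMod 2} {K : Type*} [Field K]

/-- After transposition the index of `u` increases and that of `v` decreases, as required for `rProd
p' c v u`; only the nesting of the two loops differs, and `prod_ofFn_comm` exchanges it. -/
theorem superT_relabel_rProd (hp : ∀ j, p' j = p j.rev + 1) {a b : ℕ} (c : K) (u : Fin a → K)
    (v : Fin b → K) : superT p K (relabel p K (rProd p c u v)) = rProd p' c v u := by
  simp only [rProd, relabel_prod_ofFn, relabel_rMat, finAddFlip_apply_castAdd,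
    finAddFlip_apply_natAdd]
  rw [superT_prod_ofFn fun j => by
    simpa using HasParity.prod_ofFn fun k => hasParity_rMat p c _ _ _ _]
  have (j : Fin b) := superT_prod_ofFn (K := K) (p := p) (X := fun k : Fin a =>
    rMat p c (Fin.castAdd a j) (Fin.natAdd b k.rev) (v j) (u k.rev)) fun k => hasParity_rMat p c _ _ _ _
  simp only [this, Fin.rev_rev, superT_rMat hp (castAdd_ne_natAdd _ _)]
  refine prod_ofFn_comm _ fun j j' k k' hj hk => ?_
  refine (Commute.one_left _).add_left (Commute.smul_left ?_ _)
  refine (Commute.one_right _).add_right (Commute.smul_right ?_ _)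
  exact perm_commute_perm p' (by simpa using hk.symm) (castAdd_ne_natAdd _ _).symm
    (castAdd_ne_natAdd _ _) (by simpa using hj.symm)

theorem superT_prod_elem (hp : ∀ j, p' j = p j.rev + 1) {n a : ℕ} {q : Fin a → Fin n}
    (hq : Function.Injective q) (i j : Fin 3) (hij : p i * p j + p j = 0) :
    superT p K (List.ofFn fun k => elem p K (q k) i j).prod =
      (List.ofFn fun k => elem p' K (q k) j.rev i.rev).prod := by
  have h (k : Fin a) : superT p K (elem p K (q k) i j) = elem p' K (q k) j.rev i.rev := by
    rw [superT_elem hp, hij, sgn_zero, one_smul]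
  rw [superT_prod_ofFn_of_comm fun k => hasParity_elem p (q k) i j]
  · simp only [h]
  · intro k l hkl
    rw [h, h, elem_comm p' (hq.ne hkl), hp, hp, Fin.rev_rev, Fin.rev_rev]
    congr 2
    generalize p i = x; generalize p j = y
    clear * -
    revert x y; decide

variable {B B' : Type*} [Ring B] [Algebra K B] [Ring B'] [Algebra K B']

/-- Both gradations satisfy the parity conditions: `h21` and `h32` say that `E_21` and `E_32`
transpose without a sign, and `heven` that they are not both odd, so that reversing the two groups
costs no sign either. -/
theorem map_betheTrace (hp : ∀ j, p' j = p j.rev + 1) (h21 : p 1 * p 0 + p 0 = 0)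
    (h32 : p 2 * p 1 + p 1 = 0) (heven : (p 1 + p 0) * (p 2 + p 1) = 0)
    (γ : B →+* B) (hγ : ∀ k : K, γ (algebraMap K B k) = algebraMap K B k)
    (γ' : B' →+* B') (hγ' : ∀ k : K, γ' (algebraMap K B' k) = algebraMap K B' k)
    (φ : B →+* B') (hφ : ∀ k : K, φ (algebraMap K B k) = algebraMap K B' k)
    {T : K → Fin 3 → Fin 3 → B} (hT : ∀ z, IsGraded p γ (T z))
    {T' : K → Fin 3 → Fin 3 → B'} (hT' : ∀ z, IsGraded p' γ' (T' z))
    (hφT : ∀ z i j, φ (T z i j) = sgn (p i * p j + p j + 1) • T' z j.rev i.rev)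
    {a b : ℕ} (c : K) (u : Fin a → K) (v : Fin b → K)
    (huv : ∀ k j, ExchangeRel p (c / (u k - v j)) (T (u k)) (T (v j))) :
    φ (betheTrace p (algebraMap K B) γ c T u v) =
      betheTrace p' (algebraMap K B') γ' c T' v u := by
  -- RTT moves `ℝ` to the left of the monodromy matrices, cyclicity moves it to the right end, and
  -- the flip puts the spaces of `v` first.
  have h1 : betheTrace p (algebraMap K B) γ c T u v =
      superTrace p γ ((List.ofFn fun q => tMat p γ q (T (Fin.append v u q))).prod *
        (relabel p K ((List.ofFn fun k : Fin a => elem p K (Fin.castAdd b k) 1 0).prod *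
          (List.ofFn fun j : Fin b => elem p K (Fin.natAdd a j) 2 1).prod *
          rProd p c u v)).map (algebraMap K B)) := by
    rw [betheTrace, mul_assoc (rProd p c u v), Matrix.map_mul, ← mul_assoc,
      tMat_prod_mul_rProd p γ hγ c u v T (fun _ => hT _) (fun _ => hT _) huv, mul_assoc,
      superTrace_mul_comm p γ (hasParity_rProd p c u v), mul_assoc, ← Matrix.map_mul,
      ← superTrace_relabel, map_mul, relabel_map, map_mul, relabel_prod_ofFn, relabel_prod_ofFn,
      prod_ofFn_append v u fun q z => tMat p γ q (T z)]
    simp only [relabel_tMat, finAddFlip_apply_castAdd, finAddFlip_apply_natAdd]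
  -- Transposition reverses the three blocks, so `ℝ` returns to the front and the two groups of
  -- elementary matrices change places.
  have h2 : superT p K (relabel p K
      ((List.ofFn fun k : Fin a => elem p K (Fin.castAdd b k) 1 0).prod *
        (List.ofFn fun j : Fin b => elem p K (Fin.natAdd a j) 2 1).prod * rProd p c u v)) =
      rProd p' c v u *
        (List.ofFn fun j : Fin b => elem p' K (Fin.castAdd a j) 1 0).prod *
        (List.ofFn fun k : Fin a => elem p' K (Fin.natAdd b k) 2 1).prod := by
    have e1 : HasParity p 0 (relabel p K (rProd p c u v)) := by
      intro I J h
      rw [relabel_apply] at h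
      have := hasParity_rProd p c u v _ _ fun h0 => h (by rw [h0, smul_zero])
      rwa [par_comp_flip, par_comp_flip] at this
    have e2 := HasParity.prod_ofFn fun k : Fin a =>
      hasParity_elem p (R := K) (Fin.natAdd b k) 1 0
    have e3 := HasParity.prod_ofFn fun j : Fin b =>
      hasParity_elem p (R := K) (Fin.castAdd a j) 2 1
    have e4 : (a * (p 1 + p 0)) * (b * (p 2 + p 1)) = 0 := by
      linear_combination (a * b : ZMod 2) * heven
    rw [map_mul (relabel p K), map_mul (relabel p K), relabel_prod_ofFn, relabel_prod_ofFn]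
    simp only [relabel_elem, finAddFlip_apply_castAdd, finAddFlip_apply_natAdd]
    rw [superT_mul (e2.mul e3) e1, superT_mul e2 e3, e4, mul_zero, sgn_zero, one_smul, one_smul,
      superT_relabel_rProd hp, superT_prod_elem hp (Fin.natAdd_injective a b) 1 0 h21,
      superT_prod_elem hp (Fin.castAdd_injective b a) 2 1 h32, mul_assoc]
    rfl
  rw [h1, map_superTrace_tMat_prod_mul γ hp hγ γ' hγ' (fun _ => hT _)
    (T' := fun q => T' (Fin.append v u q)) (fun _ => hT' _) φ hφ (fun _ => hφT _), h2,
    prod_ofFn_append v u fun q z => tMat p' γ' q (T' z)]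
  rfl

end Trace

open HahnSeries

/-! ### Hahn series with coefficients in a noncommutative algebra -/

section Hahn

variable {Γ : Type*} [AddCommGroup Γ] [LinearOrder Γ] [IsOrderedAddMonoid Γ]

/-- A ring homomorphism, applied coefficientwise. -/
def mapCoeff {R S : Type*} [Semiring R] [Semiring S] (f : R →+* S) : R⟦Γ⟧ →+* S⟦Γ⟧ where
  toFun x := x.map f
  map_one' := HahnSeries.map_one f.toMonoidWithZeroHom
  map_zero' := by ext; simp
  map_add' x y := by ext; simp
  map_mul' x y := HahnSeries.map_mul (f : R →ₙ+* S)

theorem coeff_mapCoeff {R S : Type*} [Semiring R] [Semiring S] (f : R →+* S) (x : R⟦Γ⟧) (g : Γ) :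
    (mapCoeff f x).coeff g = f (x.coeff g) := rfl

section Scalars

variable {k A : Type*} [Field k] [Ring A] [Algebra k A]

theorem mapCoeff_algebraMap_commutes (x : k⟦Γ⟧) (y : A⟦Γ⟧) :
    mapCoeff (algebraMap k A) x * y = y * mapCoeff (algebraMap k A) x := by
  ext g
  simp_rw [coeff_mul, coeff_mapCoeff, Algebra.commutes]
  exact Finset.sum_equiv (Equiv.prodComm _ _) (fun _ ↦ Finset.swap_mem_antidiagonal.symm) <| by simp

variable (Γ k A) in
/-- The coefficientwise `k⟦Γ⟧`-algebra structure on `A⟦Γ⟧`. -/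
abbrev hahnAlgebra : Algebra k⟦Γ⟧ A⟦Γ⟧ where
  smul x y := mapCoeff (algebraMap k A) x * y
  algebraMap := mapCoeff (algebraMap k A)
  commutes' := mapCoeff_algebraMap_commutes
  smul_def' _ _ := rfl

attribute [local instance] hahnAlgebra

theorem hahnAlgebra_algebraMap_apply (x : k⟦Γ⟧) :
    algebraMap k⟦Γ⟧ A⟦Γ⟧ x = x.map (algebraMap k A) := rfl

theorem map_toSpanSingleton (x : k⟦Γ⟧) (t : A) :
    (x.map (LinearMap.toSpanSingleton k A t) : A⟦Γ⟧) = x • (C t : A⟦Γ⟧) := by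
  ext g
  rw [Algebra.smul_def, C_apply, coeff_mul_single_zero, map_coeff, hahnAlgebra_algebraMap_apply,
    map_coeff, LinearMap.toSpanSingleton_apply, Algebra.smul_def]

/-- The family of the terms `s_α t_α`. -/
def scalarFamily {α : Type*} (s : SummableFamily Γ k α) (t : α → A) : SummableFamily Γ A α where
  toFun r := s r • (C (t r) : A⟦Γ⟧)
  isPWO_iUnion_support' := by
    refine s.isPWO_iUnion_support.mono (Set.iUnion_mono fun r g hg h0 => hg ?_)
    simp only [← map_toSpanSingleton, map_coeff, h0, map_zero]
  finite_co_support' g := by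
    refine (s.finite_co_support g).subset fun r hg h0 => hg ?_
    simp only [← map_toSpanSingleton, map_coeff, h0, map_zero]

theorem scalarFamily_apply {α : Type*} (s : SummableFamily Γ k α) (t : α → A) (r : α) :
    scalarFamily s t r = s r • (C (t r) : A⟦Γ⟧) := rfl

theorem termFamily_eq {A : Type*} [Ring A] [Algebra ℂ A] (t : ℕ → A) (x : ℂ⟦Γ⟧) :
    termFamily (Γ := Γ) t x = scalarFamily (SummableFamily.powers x) t := by
  ext1 r
  exact map_toSpanSingleton _ _

/-- The sum `∑ s_α t_α`, as a function of `t`. -/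
def scalarSum {α : Type*} (s : SummableFamily Γ k α) : (α → A) →+ A⟦Γ⟧ where
  toFun t := (scalarFamily s t).hsum
  map_zero' := by
    rw [show scalarFamily s (0 : α → A) = 0 from SummableFamily.ext fun r => by
      simp [scalarFamily_apply], SummableFamily.hsum_zero]
  map_add' t t' := by
    rw [← SummableFamily.hsum_add]
    congr 1
    ext1 r
    simp only [scalarFamily_apply, SummableFamily.add_apply, Pi.add_apply, map_add, smul_add]

theorem scalarSum_mul {α β : Type*} (s : SummableFamily Γ k α) (s' : SummableFamily Γ k β)
    (t : α → A) (t' : β → A) :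
    scalarSum s t * scalarSum s' t' = scalarSum (s.mul s') fun r => t r.1 * t' r.2 := by
  refine (SummableFamily.hsum_mul _ _).symm.trans (congrArg _ (SummableFamily.ext fun r => ?_))
  rw [SummableFamily.mul_toFun, scalarFamily_apply, scalarFamily_apply, scalarFamily_apply,
    SummableFamily.mul_toFun, smul_mul_smul_comm, map_mul]

/-- Written over the same family `s.mul s'` as the product in the other order, so that a relation
between modes can be summed term by term. -/
theorem scalarSum_mul_rev {α β : Type*} (s : SummableFamily Γ k α) (s' : SummableFamily Γ k β)
    (t : α → A) (t' : β → A) :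
    scalarSum s' t' * scalarSum s t = scalarSum (s.mul s') fun r => t' r.2 * t r.1 := by
  rw [scalarSum_mul]
  refine (SummableFamily.hsum_equiv (Equiv.prodComm β α) _).symm.trans
    (congrArg _ (SummableFamily.ext fun r => ?_))
  change (s' r.2 * s r.1) • (C (t' r.2 * t r.1) : A⟦Γ⟧) = (s r.1 * s' r.2) • C (t' r.2 * t r.1)
  rw [mul_comm]

/-- Splitting off the constant term. Positivity of the order ensures that `SummableFamily.powers x`
consists of the actual powers of `x`. -/
theorem scalarSum_powers {x : k⟦Γ⟧} (hx : 0 < x.orderTop) (t : ℕ → A) :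
    scalarSum (SummableFamily.powers x) t =
      C (t 0) + x • scalarSum (SummableFamily.powers x) fun r => t (r + 1) := by
  have h : scalarFamily (SummableFamily.powers x) t =
      SummableFamily.single 0 (C (t 0)) + (algebraMap k⟦Γ⟧ A⟦Γ⟧ x •
        scalarFamily (SummableFamily.powers x) fun r => t (r + 1)).embDomain
          ⟨Nat.succ, Nat.succ_injective⟩ := by
    refine SummableFamily.ext fun r => ?_
    rw [SummableFamily.add_apply, scalarFamily_apply, SummableFamily.powers_of_orderTop_pos hx]
    cases r with
    | zero =>
      rw [SummableFamily.embDomain_of_notMem_range _ _ (by simp), pow_zero, one_smul, add_zero]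
      simp
    | succ r =>
      refine Eq.trans ?_ (congrArg (_ + ·)
        (SummableFamily.embDomain_image _ ⟨Nat.succ, Nat.succ_injective⟩ (a := r)).symm)
      change _ = _ + algebraMap k⟦Γ⟧ A⟦Γ⟧ x * (SummableFamily.powers x r • C (t (r + 1)))
      rw [SummableFamily.powers_of_orderTop_pos hx, ← Algebra.smul_def, smul_smul, ← pow_succ']
      simp
  change (scalarFamily _ _).hsum = _ + _ • (scalarFamily _ _).hsum
  rw [h, SummableFamily.hsum_add, SummableFamily.hsum_single, SummableFamily.hsum_embDomain,
    SummableFamily.hsum_smul, Algebra.smul_def]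

theorem mapCoeff_scalarSum {A' : Type*} [Ring A'] [Algebra k A'] (f : A →ₐ[k] A') {α : Type*}
    (s : SummableFamily Γ k α) (t : α → A) :
    mapCoeff (f : A →+* A') (scalarSum s t) = scalarSum s fun r => f (t r) := by
  ext g
  refine (AddMonoidHom.map_finsum (f : A →+ A') ((scalarFamily s t).finite_co_support g)).trans
    (finsum_congr fun r => ?_)
  change f ((scalarFamily s t r).coeff g) = _
  rw [scalarFamily_apply, scalarFamily_apply, ← map_toSpanSingleton, ← map_toSpanSingleton,
    map_coeff, map_coeff, LinearMap.toSpanSingleton_apply, LinearMap.toSpanSingleton_apply,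
    map_smul]

end Scalars

end Hahn

/-! ### From the mode relations to the exchange relation of generating series -/

section Exchange

variable {Γ : Type*} [AddCommGroup Γ] [LinearOrder Γ] [IsOrderedAddMonoid Γ]

theorem orderTop_inv_pos {k : Type*} [Field k] {z : k⟦Γ⟧} (hz : z.orderTop < 0) :
    0 < (z⁻¹).orderTop := by
  have hz0 : z ≠ 0 := by
    rintro rfl
    simp at hz
  have h := orderTop_mul z z⁻¹
  rw [mul_inv_cancel₀ hz0, orderTop_one] at h
  by_contra hle
  exact (h ▸ add_neg_of_neg_of_nonpos hz (not_lt.1 hle)).false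

attribute [local instance] hahnAlgebra

/-- The modes `t` and `t'` with the relations of the super-Yangian give generating series with the
exchange relation. -/
theorem exchange_of_mode_rel {k A : Type*} [Field k] [Ring A] [Algebra k A]
    {x y : k⟦Γ⟧} (hx : 0 < x.orderTop) (hy : 0 < y.orderTop) (a ε : ℤ)
    {t₁ t₂ t₃ t₄ : ℕ → A}
    (h : ∀ r s, (t₁ (r + 1) * t₂ s - a • (t₂ s * t₁ (r + 1))) -
      (t₁ r * t₂ (s + 1) - a • (t₂ (s + 1) * t₁ r)) = ε • (t₃ r * t₄ s - t₃ s * t₄ r))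
    (h1 : ∀ z : A⟦Γ⟧, C (t₁ 0) * z = a • (z * C (t₁ 0)))
    (h2 : ∀ z : A⟦Γ⟧, z * C (t₂ 0) = a • (C (t₂ 0) * z)) :
    (y - x) • (scalarSum (SummableFamily.powers x) t₁ * scalarSum (SummableFamily.powers y) t₂ -
      a • (scalarSum (SummableFamily.powers y) t₂ * scalarSum (SummableFamily.powers x) t₁)) =
    (x * y) • ε •
      (scalarSum (SummableFamily.powers x) t₃ * scalarSum (SummableFamily.powers y) t₄ -
      scalarSum (SummableFamily.powers y) t₃ * scalarSum (SummableFamily.powers x) t₄) := by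
  -- The relation at `(r, s)` is multiplied by `x^r y^s` and summed over all `r, s`.
  have key := congrArg (scalarSum ((SummableFamily.powers x).mul (SummableFamily.powers y)))
    (funext fun r : ℕ × ℕ => h r.1 r.2)
  have e1 := fun f g : ℕ → A => scalarSum_mul (SummableFamily.powers x) (SummableFamily.powers y) f g
  have e2 := fun f g : ℕ → A =>
    scalarSum_mul_rev (SummableFamily.powers x) (SummableFamily.powers y) f g
  have key' : (scalarSum (SummableFamily.powers x) (fun r => t₁ (r + 1)) *
        scalarSum (SummableFamily.powers y) t₂ -
      a • (scalarSum (SummableFamily.powers y) t₂ *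
        scalarSum (SummableFamily.powers x) (fun r => t₁ (r + 1)))) -
      (scalarSum (SummableFamily.powers x) t₁ *
        scalarSum (SummableFamily.powers y) (fun r => t₂ (r + 1)) -
      a • (scalarSum (SummableFamily.powers y) (fun r => t₂ (r + 1)) *
        scalarSum (SummableFamily.powers x) t₁)) =
      ε • (scalarSum (SummableFamily.powers x) t₃ * scalarSum (SummableFamily.powers y) t₄ -
      scalarSum (SummableFamily.powers y) t₃ * scalarSum (SummableFamily.powers x) t₄) := by
    simp only [e1, e2, ← map_zsmul, ← map_sub]
    exact key
  have p1 := scalarSum_powers hx t₁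
  have p2 := scalarSum_powers hy t₂
  rw [← key']
  generalize scalarSum (SummableFamily.powers x) t₁ = X at *
  generalize scalarSum (SummableFamily.powers y) t₂ = Y at *
  generalize scalarSum (SummableFamily.powers x) (fun r => t₁ (r + 1)) = X' at *
  generalize scalarSum (SummableFamily.powers y) (fun r => t₂ (r + 1)) = Y' at *
  have q1 : x • X' = X - C (t₁ 0) := by rw [p1, add_sub_cancel_left]
  have q2 : y • Y' = Y - C (t₂ 0) := by rw [p2, add_sub_cancel_left]
  have r1 : (x * y) • (X' * Y) = y • (X * Y - C (t₁ 0) * Y) := by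
    rw [mul_comm x, mul_smul, ← smul_mul_assoc, q1, sub_mul]
  have r2 : (x * y) • (Y * X') = y • (Y * X - Y * C (t₁ 0)) := by
    rw [mul_comm x, mul_smul, ← mul_smul_comm x, q1, mul_sub]
  have r3 : (x * y) • (X * Y') = x • (X * Y - X * C (t₂ 0)) := by
    rw [mul_smul, ← mul_smul_comm y, q2, mul_sub]
  have r4 : (x * y) • (Y' * X) = x • (Y * X - C (t₂ 0) * X) := by
    rw [mul_smul, ← smul_mul_assoc, q2, sub_mul]
  -- The shifted series differ from the full ones by constant terms; these commute up to the sign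
  -- `a` and cancel in the graded commutators.
  rw [h1] at r1
  rw [h2] at r3
  have s1 : (x * y) • a • (Y * X') = a • (x * y) • (Y * X') := smul_comm _ _ _
  have s2 : (x * y) • a • (Y' * X) = a • (x * y) • (Y' * X) := smul_comm _ _ _
  simp only [smul_sub (x * y)]
  rw [s1, s2, r1, r2, r3, r4]
  module

variable {N : ℕ} (p : Fin N → ZMod 2) (κ c : ℂ)

theorem monodromy_eq (z : ℂ⟦Γ⟧) (i j : Fin N) :
    monodromy p κ c z i j = scalarSum (SummableFamily.powers (C c * z⁻¹)) (mode p κ i j) := by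
  rw [monodromy, termFamily_eq]
  rfl

theorem monodromy_exchange (hc : c ≠ 0) {z w : ℂ⟦Γ⟧} (hz : z.orderTop < 0) (hw : w.orderTop < 0)
    (hzw : z ≠ w) :
    ExchangeRel p (C c / (z - w)) (monodromy p κ c z) (monodromy p κ c w) := by
  have hpos {z : ℂ⟦Γ⟧} (hz : z.orderTop < 0) : 0 < (C c * z⁻¹).orderTop := by
    rw [orderTop_mul, C_apply, orderTop_single hc]
    simpa using orderTop_inv_pos hz
  have h0 {z : ℂ⟦Γ⟧} (hz : z.orderTop < 0) : z ≠ 0 := by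
    rintro rfl
    simp at hz
  have hC : (C c : ℂ⟦Γ⟧) ≠ 0 := by simpa using hc
  intro i j k l
  -- The zeroth mode is a scalar on the diagonal, where the sign is trivial, and zero elsewhere.
  have hmode (i j : Fin N) (b : ZMod 2) (x : (SuperYangian p κ)⟦Γ⟧) :
      C (mode p κ i j 0) * x = sgn ((p i + p j) * b) • (x * C (mode p κ i j 0)) := by
    rw [mode_zero]
    by_cases hij : i = j
    · subst hij
      rw [add_self, zero_mul, sgn_zero, one_smul, if_pos rfl]
      have : (C (algebraMap ℂ (SuperYangian p κ) κ) : (SuperYangian p κ)⟦Γ⟧) =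
        algebraMap ℂ⟦Γ⟧ _ (C κ) := (map_C κ (algebraMap ℂ (SuperYangian p κ))).symm
      rw [this, Algebra.commutes]
    · simp [hij]
  have key := exchange_of_mode_rel (hpos hz) (hpos hw) _ _ (mode_rel p κ i j k l)
    (hmode i j _) (fun x => by
      rw [hmode k l (p i + p j), smul_smul, mul_comm (p k + p l), sgn_mul_self, one_smul])
  simp only [← monodromy_eq] at key
  -- With `x = c / z` and `y = c / w` this reads `y - x = x y (z - w) / c`, so dividing by `x y`
  -- produces the factor `g(z, w)`.
  have e : (C c * w⁻¹ - C c * z⁻¹) = (C c * z⁻¹) * (C c * w⁻¹) * ((C c)⁻¹ * (z - w)) := by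
    have := h0 hz
    have := h0 hw
    field_simp
  have hne : (C c * z⁻¹) * (C c * w⁻¹) ≠ 0 :=
    mul_ne_zero (mul_ne_zero hC (inv_ne_zero (h0 hz))) (mul_ne_zero hC (inv_ne_zero (h0 hw)))
  have hd : z - w ≠ 0 := sub_ne_zero.2 hzw
  generalize (C c * z⁻¹) * (C c * w⁻¹) = m at *
  have e1 : C c / (z - w) * m⁻¹ * (m * ((C c)⁻¹ * (z - w))) = 1 := by field_simp
  have e2 : C c / (z - w) * m⁻¹ * m = C c / (z - w) := by field_simp
  have key' := congrArg (fun v => (C c / (z - w) * m⁻¹) • v) key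
  simp only [e] at key'
  rw [smul_smul, smul_smul, e1, e2, one_smul, smul_comm] at key'
  exact key'

end Exchange

/-! ### Transport of traces, Bethe vectors and singular vectors -/

section Main

variable {Γ : Type*} [AddCommGroup Γ] [LinearOrder Γ] [IsOrderedAddMonoid Γ]

attribute [local instance] hahnAlgebra

theorem mapCoeff_monodromy {N : ℕ} {p q : Fin N → ZMod 2} {κ κ' : ℂ} (c : ℂ)
    (f : SuperYangian p κ →ₐ[ℂ] SuperYangian q κ') {i j i' j' : Fin N} {d : ZMod 2}
    (h : ∀ r, f (mode p κ i j r) = sgn d • mode q κ' i' j' r) (z : ℂ⟦Γ⟧) :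
    mapCoeff (f : SuperYangian p κ →+* SuperYangian q κ') (monodromy p κ c z i j) =
      sgn d • monodromy q κ' c z i' j' := by
  rw [monodromy_eq, monodromy_eq, mapCoeff_scalarSum, ← map_zsmul]
  exact congrArg _ (funext h)

theorem mapCoeff_algebraMap {k A A' : Type*} [Field k] [Ring A] [Algebra k A] [Ring A'] [Algebra k A']
    (f : A →ₐ[k] A') (x : k⟦Γ⟧) :
    mapCoeff (f : A →+* A') (algebraMap k⟦Γ⟧ A⟦Γ⟧ x) = algebraMap k⟦Γ⟧ A'⟦Γ⟧ x := by
  ext g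
  exact f.commutes _

theorem monodromy_isGraded {N : ℕ} (p : Fin N → ZMod 2) (κ c : ℂ) (z : ℂ⟦Γ⟧) :
    IsGraded p (mapCoeff (gr p κ : SuperYangian p κ →+* SuperYangian p κ)) (monodromy p κ c z) :=
  fun _ _ => mapCoeff_monodromy c _ (fun _ => lift_mode _ _ _ _ _ _ _ _) z

theorem map_yangianTrace {p q : Fin 3 → ZMod 2} (hpq : ∀ j, q j = p j.rev + 1)
    (hqp : ∀ j, p j = q j.rev + 1) (h21 : p 1 * p 0 + p 0 = 0) (h32 : p 2 * p 1 + p 1 = 0)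
    (heven : (p 1 + p 0) * (p 2 + p 1) = 0) (κ : ℂ) {c : ℂ} (hc : c ≠ 0) {a b : ℕ}
    {u : Fin a → ℂ⟦Γ⟧} {v : Fin b → ℂ⟦Γ⟧} (hu : ∀ i, (u i).orderTop < 0)
    (hv : ∀ j, (v j).orderTop < 0) (huv : ∀ i j, u i ≠ v j) :
    (yangianTrace p κ c u v).map (iso p q hpq hqp κ) = yangianTrace q (-κ) c v u := by
  have h (p : Fin 3 → ZMod 2) (κ : ℂ) {a b : ℕ} (u : Fin a → ℂ⟦Γ⟧) (v : Fin b → ℂ⟦Γ⟧) :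
      yangianTrace p κ c u v =
        betheTrace p (algebraMap ℂ⟦Γ⟧ (SuperYangian p κ)⟦Γ⟧)
          (mapCoeff (gr p κ : SuperYangian p κ →+* SuperYangian p κ)) (C c) (monodromy p κ c) u v :=
    rfl
  have hφ (z : ℂ⟦Γ⟧) (i j : Fin 3) :
      mapCoeff (isoHom p q hpq κ (-κ) rfl : SuperYangian p κ →+* SuperYangian q (-κ))
        (monodromy p κ c z i j) =
      sgn (p i * p j + p j + 1) • monodromy q (-κ) c z j.rev i.rev :=
    mapCoeff_monodromy c _ (isoHom_mode p q hpq κ (-κ) rfl i j) z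
  have huv' (k : Fin a) (j : Fin b) := monodromy_exchange p κ c hc (hu k) (hv j) (huv k j)
  rw [h, h]
  exact map_betheTrace hpq h21 h32 heven _ (mapCoeff_algebraMap _) _ (mapCoeff_algebraMap _) _
    (mapCoeff_algebraMap _) (monodromy_isGraded p κ c) (monodromy_isGraded q (-κ) c) hφ (C c) u v
    huv'

/-- The vector `Ω` sits in degree zero, so only the pair `(g, 0)` contributes. This reduces
compatibility with `F` to a statement about single coefficients. -/
theorem coeff_applyTo {Y V : Type*} [Ring Y] [Algebra ℂ Y] [AddCommGroup V] [Module Y V]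
    (s : ℂ⟦Γ⟧) (x : Y⟦Γ⟧) (Ω : V) (g : Γ) :
    (applyTo s x Ω).coeff g = (s.map (algebraMap ℂ Y) * x).coeff g • Ω := by
  rw [applyTo]
  generalize s.map (algebraMap ℂ Y) * x = z
  rw [HahnModule.coeff_smul]
  simp only [Equiv.symm_apply_apply]
  rw [Finset.sum_eq_single (g, 0)]
  · simp
  · rintro ⟨g1, g2⟩ h hne
    rw [Finset.mem_vaddAntidiagonal] at h
    by_cases h2 : g2 = 0
    · subst h2
      exact absurd (by simpa using h.2.2) fun h' : g1 = g => hne (by rw [h'])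
    · rw [coeff_single_of_ne h2, smul_zero]
  · intro h
    by_contra h'
    apply h
    rw [Finset.mem_vaddAntidiagonal]
    refine ⟨fun h0 => h' ?_, fun h0 => h' ?_, by simp⟩
    · simp only [h0, zero_smul]
    · simp only [h0, smul_zero]

theorem map_applyTo {Y Y' V W : Type*} [Ring Y] [Algebra ℂ Y] [Ring Y'] [Algebra ℂ Y']
    [AddCommGroup V] [Module Y V] [AddCommGroup W] [Module Y' W] (φ : Y ≃ₐ[ℂ] Y') (F : V →+ W)
    (hF : ∀ (y : Y) (x : V), F (y • x) = φ y • F x) (s : ℂ⟦Γ⟧) (x : Y⟦Γ⟧) (Ω : V) :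
    (applyTo s x Ω).map F = applyTo s (x.map φ) (F Ω) := by
  ext g
  rw [map_coeff, coeff_applyTo, coeff_applyTo, hF]
  congr 1
  have := congrArg (fun z => z.coeff g)
    (map_mul (mapCoeff (Γ := Γ) (φ : Y →ₐ[ℂ] Y').toRingHom) (s.map (algebraMap ℂ Y)) x)
  refine this.trans ?_
  congr 2
  exact mapCoeff_algebraMap (φ : Y →ₐ[ℂ] Y') s

/-- Transposition and reversal each exchange the two triangles, so together they preserve the lower
one; on the diagonal the sign is `-1` because `[i][i] + [i] = 0`. -/
theorem isSingular_map {N : ℕ} {p q : Fin N → ZMod 2} (hpq : ∀ j, q j = p j.rev + 1)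
    (hqp : ∀ j, p j = q j.rev + 1) {κ : ℂ} {V W : Type*} [AddCommGroup V]
    [Module (SuperYangian p κ) V] [AddCommGroup W] [Module (SuperYangian q (-κ)) W] (F : V →+ W)
    (hF : ∀ (y : SuperYangian p κ) (x : V), F (y • x) = iso p q hpq hqp κ y • F x) {Ω : V}
    {lam : Fin N → ℕ → ℂ} (h : IsSingular p κ Ω lam) :
    IsSingular q (-κ) (F Ω) fun i r => -lam i.rev r := by
  have hmode (i j : Fin N) (r : ℕ) : F (mode p κ i j r • Ω) =
      sgn (p i * p j + p j + 1) • mode q (-κ) j.rev i.rev r • F Ω := by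
    rw [hF, ← smul_assoc]
    exact congrArg (· • F Ω) (isoHom_mode p q hpq κ (-κ) rfl i j r)
  refine ⟨fun i r => ?_, fun i j r hij => ?_⟩
  · have h1 := hmode i.rev i.rev r
    have h2 : p i.rev * p i.rev + p i.rev + 1 = 1 := by
      linear_combination mul_self_parity (p i.rev) + add_self (p i.rev)
    rw [h.diag, hF, AlgEquiv.commutes, h2, Fin.rev_rev] at h1
    rw [map_neg, neg_smul, h1]
    simp [sgn]
  · have h1 := hmode j.rev i.rev r
    rw [h.lower _ _ _ (Fin.rev_lt_rev.2 hij), map_zero, Fin.rev_rev, Fin.rev_rev] at h1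
    have h2 := congrArg (fun x => sgn (p j.rev * p i.rev + p i.rev + 1) • x) h1.symm
    rwa [smul_smul, sgn_mul_self, one_smul, smul_zero] at h2

end Main

end SuperYangian
end

open SuperYangian HahnSeries in
theorem mainTheorem5 {Γ : Type*} [AddCommGroup Γ] [LinearOrder Γ] [IsOrderedAddMonoid Γ]
    (c : ℂ) (hc : c ≠ 0) (κ : ℂ) {a b : ℕ} (u : Fin a → HahnSeries Γ ℂ) (v : Fin b → HahnSeries Γ ℂ)
    (hu : ∀ i, (u i).orderTop < 0) (hv : ∀ j, (v j).orderTop < 0) (huv : ∀ i j, u i ≠ v j) :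
    (∀ {V W : Type*} [AddCommGroup V] [Module (SuperYangian grad21 κ) V]
        [AddCommGroup W] [Module (SuperYangian grad12 (-κ)) W]
        (F : V →+ W) (_ : ∀ (y : SuperYangian grad21 κ) (x : V), F (y • x) = phi κ y • F x)
        (Ω : V) (lam : Fin 3 → ℕ → ℂ) (_ : IsSingular grad21 κ Ω lam),
        IsSingular grad12 (-κ) (F Ω) (fun i r => -lam i.rev r) ∧
          (bethe21 κ c u v Ω).map F = bethe12 (-κ) c v u (F Ω)) ∧
      (∀ {V W : Type*} [AddCommGroup V] [Module (SuperYangian grad12 κ) V]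
        [AddCommGroup W] [Module (SuperYangian grad21 (-κ)) W]
        (F : V →+ W) (_ : ∀ (y : SuperYangian grad12 κ) (x : V), F (y • x) = phiTilde κ y • F x)
        (Ω : V) (lam : Fin 3 → ℕ → ℂ) (_ : IsSingular grad12 κ Ω lam),
        IsSingular grad21 (-κ) (F Ω) (fun i r => -lam i.rev r) ∧
          (bethe12 κ c u v Ω).map F = bethe21 (-κ) c v u (F Ω)) := by
  refine ⟨fun F hF Ω lam h => ⟨isSingular_map (by decide) (by decide) F hF h, ?_⟩,
    fun F hF Ω lam h => ⟨isSingular_map (by decide) (by decide) F hF h, ?_⟩⟩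
  -- The scalar prefactors agree definitionally: after the exchange of `u` and `v`, both are `(-1)^b
  -- / H(v)`.
  · refine (map_applyTo (phi κ) F hF _ _ Ω).trans ?_
    exact congrArg (fun x => applyTo _ x (F Ω)) (map_yangianTrace (p := grad21) (q := grad12)
      (by decide) (by decide) (by decide) (by decide) (by decide) κ hc hu hv huv)
  · refine (map_applyTo (phiTilde κ) F hF _ _ Ω).trans ?_
    exact congrArg (fun x => applyTo _ x (F Ω)) (map_yangianTrace (p := grad12) (q := grad21)
      (by decide) (by decide) (by decide) (by decide) (by decide) κ hc hu hv huv)
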